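/- Let $g\ge 3$. Let $\mathcal L$ be the infinite Jacob's ladder surface (two ends, both accumulated by genus), let $h_{g-1}$ be the handle shift of $\mathcal L$ by $g-1$ units, let $S_g=\mathcal L/\langle h_{g-1}\rangle$, which is the closed orientable surface of genus $g$, and let $q_g:\mathcal L\to S_g$ be the corresponding infinite cyclic covering map. (Concretely, one may take $\mathcal L=\{(x,y,z)\in\mathbb R^3: z^2=(4-y^2)(y^2+\sin^2(\pi x)-\tfrac14)\}$ and $h_{g-1}(x,y,z)=(x+g-1,y,z)$.) A singular measured foliation $(\mathcal F,\mu)$ on a surface is given, off its set of singularities, by a maximal atlas of charts to the $(x,y)$-plane with transition maps locally of the form $(x,y)\mapsto (h(x,y),c\pm y)$, the leaves being horizontal and the transverse measure $\mu$ being $|dy|$; each singularity is the centre of a complex chart $\zeta$ in which the foliation is given by $|d\,\mathrm{Im}(\zeta^{k/2})|$ for some integer $k\ge 3$. Two of them are transverse if they have the same singularities, are given by $|dy|$ and $|dx|$ in common charts $(x,y)$ near every regular point, and by $|d\,\mathrm{Im}(\zeta^{k/2})|$ and $|d\,\mathrm{Re}(\zeta^{k/2})|$ in a common complex chart $\zeta$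 near every singularity. For a homeomorphism or covering map $p$ and $c>0$, write $p((\mathcal F,\mu))=(\mathcal G,c\,\nu)$ if the singularities of $\mathcal F$ are the points lying over those of $\mathcal G$, $p$ maps leaves locally to leaves, and $\mu(\gamma)=c\,\nu(p\circ\gamma)$ for arcs $\gamma$. A foliation is arational if it has no closed leaf, no cycle of leaves and no saddle connection, that is, no simple closed curve is contained in a (singular) leaf, and no simple arc in a (singular) leaf contains two singularities. Let $f:S_g\to S_g$ be a pseudo-Anosov homeomorphism with stretch factor $\lambda>1$, preserving a transverse pair $(\mathcal F_s,\mu_s)$, $(\mathcal F_u,\mu_u)$ of singular measured foliations, so that $$f((\mathcal F_u,\mu_u))=(\mathcal F_u,\lambda\mu_u)\quad\text{and}\quad f((\mathcal F_s,\mu_s))=(\mathcal F_s,\lambda^{-1}\mu_s),$$ and let the homeomorphism $\widetilde f:\mathcal L\to\mathcal L$ be a lift of $f$ under $q_g$, i.e. $q_g\circ\widetilde f=f\circ q_g$. Then there exists a transverse pair $(\widetilde{\mathcal F}_s,\widetilde\mu_s)$, $(\widetilde{\mathcal F}_u,\widetilde\mu_u)$ of singular measured foliations on $\mathcal L$ such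 that both are arational, both have a countably infinite set of singularities, which is closed and all of whose points are isolated, and (i) $q_g((\widetilde{\mathcal F}_s,\widetilde\mu_s))=(\mathcal F_s,\mu_s)$ and $q_g((\widetilde{\mathcal F}_u,\widetilde\mu_u))=(\mathcal F_u,\mu_u)$; (ii) $\widetilde f((\widetilde{\mathcal F}_u,\widetilde\mu_u))=(\widetilde{\mathcal F}_u,\lambda\widetilde\mu_u)$ and $\widetilde f((\widetilde{\mathcal F}_s,\widetilde\mu_s))=(\widetilde{\mathcal F}_s,\lambda^{-1}\widetilde\mu_s)$. -/

import Mathlib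

open Topology

noncomputable section

/-! ## The ladder surface, the handle shift and the cyclic cover -/

/-- Jacob's ladder surface as a subset of `ℝ³`: the smooth surface
`z² = (4 - y²) (y² + sin² (π x) - 1/4)`.  The right-hand side is nonnegative exactly on the infinite
strip `|y| ≤ 2` with an oval hole removed around each point `(n, 0)`, `n ∈ ℤ`; the surface is the
double of that region, i.e. an infinite cylinder with one handle for each integer. It has two ends,
both of them accumulated by genus. -/
def ladderSet : Set (ℝ × ℝ × ℝ) :=
  {v | v.2.2 ^ 2 = (4 - v.2.1 ^ 2) * (v.2.1 ^ 2 + Real.sin (Real.pi * v.1) ^ 2 - 1 / 4)}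

/-- Jacob's ladder surface, with the topology induced from `ℝ³`. -/
abbrev Ladder : Type := ladderSet

theorem ladderSet_shift (m : ℤ) {v : ℝ × ℝ × ℝ} (hv : v ∈ ladderSet) :
    ((v.1 + m, v.2.1, v.2.2) : ℝ × ℝ × ℝ) ∈ ladderSet := by
  have h : Real.sin (Real.pi * (v.1 + m)) ^ 2 = Real.sin (Real.pi * v.1) ^ 2 := by
    have e : Real.pi * (v.1 + m) = Real.pi * v.1 + m * Real.pi := by ring
    rw [e, Real.sin_add_int_mul_pi, mul_pow, ← zpow_natCast, ← zpow_mul, mul_comm m, zpow_mul]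
    simp
  simp only [ladderSet, Set.mem_ofPred_eq] at hv ⊢
  rw [h]; exact hv

/-- The handle shift by `m` units, `(x, y, z) ↦ (x + m, y, z)`: it carries each handle of the ladder
to the handle `m` places further to the right. -/
def handleShift (m : ℤ) : Ladder ≃ₜ Ladder where
  toFun v := ⟨(v.1.1 + m, v.1.2.1, v.1.2.2), ladderSet_shift m v.2⟩
  invFun v := ⟨(v.1.1 + (-m : ℤ), v.1.2.1, v.1.2.2), ladderSet_shift (-m) v.2⟩
  left_inv v := by ext <;> simp
  right_inv v := by ext <;> simp
  continuous_toFun := by fun_prop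
  continuous_invFun := by fun_prop

/-- Two points of the ladder are equivalent when they differ by a power of the handle shift
`h_{g-1}` by `g - 1` units. -/
def shiftSetoid (g : ℕ) : Setoid Ladder where
  r v w := ∃ n : ℤ, (handleShift ((g : ℤ) - 1) ^ n) v = w
  iseqv :=
    { refl := fun v => ⟨0, by simp⟩
      symm := by
        rintro v w ⟨n, rfl⟩
        refine ⟨-n, ?_⟩
        rw [← Homeomorph.mul_apply, ← zpow_add]
        simp
      trans := by
        rintro u v w ⟨n, rfl⟩ ⟨m, rfl⟩
        refine ⟨m + n, ?_⟩
        rw [zpow_add, Homeomorph.mul_apply] }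

/-- The closed orientable surface `S_g` of genus `g` (for `g ≥ 2`), as the quotient of the ladder by
the infinite cyclic group generated by `h_{g-1}`, with the quotient topology.  It is the double of an
annulus with `g - 1` holes. -/
abbrev ClosedSurface (g : ℕ) : Type := Quotient (shiftSetoid g)

/-- The infinite cyclic cover `q_g : 𝓛 → S_g`. -/
def ladderCover (g : ℕ) : Ladder → ClosedSurface g := Quotient.mk (shiftSetoid g)

/-! ## Singular measured foliations -/

section Foliations

variable {X Y : Type*} [TopologicalSpace X] [TopologicalSpace Y]

/-- Two charts into the `(x, y)`-plane define the same horizontal leaves and the same transverse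
measure `|dy|` on their common domain: locally their `y`-coordinates agree up to sign and an additive
constant, i.e. the transition maps are locally of the form `(x, y) ↦ (h (x, y), c ± y)`. -/
def MeasuredCompatible (φ ψ : OpenPartialHomeomorph X (ℝ × ℝ)) : Prop :=
  ∀ x ∈ φ.source ∩ ψ.source, ∃ ε b : ℝ, (ε = 1 ∨ ε = -1) ∧
    ∀ᶠ x' in 𝓝 x, (φ x').2 = ε * (ψ x').2 + b

/-- `φ` is a local branch of `ζ ^ (k / 2)` on an open set that does not contain the centre `p` of
the complex chart `ζ`. -/
def IsProngBranch (ζ : OpenPartialHomeomorph X ℂ) (p : X) (k : ℕ)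
    (φ : OpenPartialHomeomorph X (ℝ × ℝ)) : Prop :=
  φ.source ⊆ ζ.source \ {p} ∧ ∀ x ∈ φ.source, (⟨(φ x).1, (φ x).2⟩ : ℂ) ^ 2 = ζ x ^ k

/-- A singular measured foliation `(𝓕, μ)` on a surface `X`: a set of singularities and, on its
complement, a maximal atlas of natural charts, in which the leaves are the horizontal lines and the
transverse measure `μ` of an arc is the total variation of `y` along it.  Each singularity is a
`k`-prong singularity with `k ≥ 3`: it is the centre of a complex chart `ζ` in which the leaves are
the level curves of `Im (ζ ^ (k / 2))` and the transverse measure is `|d Im (ζ ^ (k / 2))|`. -/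
structure SingularMeasuredFoliation (X : Type*) [TopologicalSpace X] where
  /-- the set of singularities -/
  sing : Set X
  /-- the natural charts -/
  charts : Set (OpenPartialHomeomorph X (ℝ × ℝ))
  source_subset : ∀ φ ∈ charts, φ.source ⊆ singᶜ
  exists_chart : ∀ x ∉ sing, ∃ φ ∈ charts, x ∈ φ.source
  compatible : ∀ φ ∈ charts, ∀ ψ ∈ charts, MeasuredCompatible φ ψ
  maximal : ∀ φ : OpenPartialHomeomorph X (ℝ × ℝ), φ.source ⊆ singᶜ →
    (∀ ψ ∈ charts, MeasuredCompatible φ ψ) → φ ∈ charts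
  exists_prong : ∀ p ∈ sing, ∃ k : ℕ, 3 ≤ k ∧ ∃ ζ : OpenPartialHomeomorph X ℂ,
    p ∈ ζ.source ∧ ζ p = 0 ∧ ∀ φ, IsProngBranch ζ p k φ → φ ∈ charts

namespace SingularMeasuredFoliation

/-- `(F, μ)` and `(G, ν)` are transverse: they have the same singularities; near every other point
there are coordinates `(x, y)` in which `F` is horizontal with measure `|dy|` and `G` is vertical with
measure `|dx|`; near each singularity there is a complex coordinate `ζ` in which the two are given by
the imaginary and the real part of `ζ ^ (k / 2)` for one and the same `k`. -/
structure Transverse (F G : SingularMeasuredFoliation X) : Prop where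
  sing_eq : F.sing = G.sing
  regular : ∀ x ∉ F.sing, ∃ φ ∈ F.charts, x ∈ φ.source ∧
    φ.transHomeomorph (Homeomorph.prodComm ℝ ℝ) ∈ G.charts
  singular : ∀ p ∈ F.sing, ∃ k : ℕ, 3 ≤ k ∧ ∃ ζ : OpenPartialHomeomorph X ℂ,
    p ∈ ζ.source ∧ ζ p = 0 ∧ ∀ φ, IsProngBranch ζ p k φ →
      φ ∈ F.charts ∧ φ.transHomeomorph (Homeomorph.prodComm ℝ ℝ) ∈ G.charts

/-- For a homeomorphism or a covering map `p : X → Y`, this is the relation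
`p ((F, μ)) = (G, c ν)`: the singularities of `F` are the points over those of `G`, `p` carries leaves
to leaves, and the transverse measure `μ` of an arc `γ` is `c ν (p γ)`.  In natural charts `y_F` of
`F` and `y_G` of `G` the last two say that locally `y_F = ± c (y_G ∘ p) + b`. -/
def HasImage (F : SingularMeasuredFoliation X) (p : X → Y) (c : ℝ)
    (G : SingularMeasuredFoliation Y) : Prop :=
  F.sing = p ⁻¹' G.sing ∧
  ∀ φ ∈ F.charts, ∀ ψ ∈ G.charts, ∀ x ∈ φ.source, p x ∈ ψ.source →
    ∃ ε b : ℝ, (ε = 1 ∨ ε = -1) ∧ ∀ᶠ x' in 𝓝 x, (φ x').2 = ε * (c * (ψ (p x')).2) + b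

/-- A path that runs inside one (possibly singular) leaf: near each time at which it is at a regular
point, it stays in the plaque through that point. -/
def IsLeafPath (F : SingularMeasuredFoliation X) (γ : C(unitInterval, X)) : Prop :=
  ∀ t, ∀ φ ∈ F.charts, γ t ∈ φ.source → ∀ᶠ s in 𝓝 t, (φ (γ s)).2 = (φ (γ t)).2

/-- A foliation is arational if it has no closed leaves, no cycles of leaves and no saddle
connections: a path in a (singular) leaf without self-intersections in `[0, 1)` is not closed up and
meets at most one singularity. -/
def IsArational (F : SingularMeasuredFoliation X) : Prop :=
  ∀ γ : C(unitInterval, X), F.IsLeafPath γ → Set.InjOn γ (Set.Ico 0 1) →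
    γ 0 ≠ γ 1 ∧ (γ ⁻¹' F.sing).Subsingleton

/-- The singularities form a countably infinite set without accumulation points: the set is closed,
and each singularity has a neighbourhood that contains no other one. -/
structure HasCountablyInfiniteIsolatedSing (F : SingularMeasuredFoliation X) : Prop where
  countable : F.sing.Countable
  infinite : F.sing.Infinite
  isolated : ∀ p ∈ F.sing, ∃ U ∈ 𝓝 p, U ∩ F.sing = {p}
  closed : IsClosed F.sing

end SingularMeasuredFoliation

/-- The homeomorphism `f` is pseudo-Anosov with stable foliation `(Fs, μs)`, unstable foliation
`(Fu, μu)` and stretch factor `lam`: the two foliations are transverse, `lam > 1`,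
`f ((Fu, μu)) = (Fu, lam μu)` and `f ((Fs, μs)) = (Fs, lam⁻¹ μs)`. -/
structure IsPseudoAnosov (f : X ≃ₜ X) (Fs Fu : SingularMeasuredFoliation X) (lam : ℝ) : Prop where
  one_lt : 1 < lam
  transverse : Fs.Transverse Fu
  unstable : Fu.HasImage f lam Fu
  stable : Fs.HasImage f lam⁻¹ Fs

end Foliations

end

/-! ### Functions that agree up to sign, scale and translation -/

/-! Both foliations are pulled back along the covering. Transversality, (i) and (ii) are local
statements and pass to the pull-backs (`Transverse.lift`, `hasImage_lift`, `HasImage.of_semiconj`).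
Two points need an argument.

Arationality (`isArational_of_contracting`). The `n`-th iterate of the lift shrinks the leaves of
the stable foliation by the factor `lam⁻¹ ^ n`, length along them being measured by the unstable
one. A deck transformation, which preserves both foliations, then brings the image of a chosen point
back into a compact fundamental domain. So a closed leaf or a saddle connection would have
arbitrarily short copies near some cluster point `q`; but `q` has a neighbourhood that contains no
such path (`exists_nhds_leafPath`). No metric is needed: shortness is the topological condition
`IsContracted`, and `Transverse.exists_stay` says that segments of small length are small in that
sense. The unstable foliation is treated by the inverse of the lift.

Infinitely many singularities (`Transverse.lift_sing_infinite`). The deck orbit of a point is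
infinite, so one singularity suffices. If there were none, the two foliations would define a flat
structure with boxes of uniform size, by cocompactness. Its developing map is defined on the whole
plane, lifts paths, and identifies points only through maps `w ↦ b + A * w` with `A` a pair of signs
(`FlatStructure.exists_developing`). Three loops around nested sets of holes give three such maps,
whose squares are translations. Three vectors in a plane have arbitrarily short non-trivial integral
combinations, yet such a combination changes the logarithm of some hole coordinate by a non-zero
multiple of `4πi`; this contradicts continuity (`FlatStructure.false_of_windings`). The argument
takes the place of the Euler–Poincaré formula. -/

/-- Along the filter `l`, the function `u` is `± c v` up to an additive constant. -/
def AffineAlong {X : Type*} (c : ℝ) (l : Filter X) (u v : X → ℝ) : Prop :=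
  ∃ ε b : ℝ, (ε = 1 ∨ ε = -1) ∧ ∀ᶠ x in l, u x = ε * (c * v x) + b

namespace AffineAlong

variable {X Y : Type*} {c d : ℝ} {l : Filter X} {u v w : X → ℝ}

theorem symm (h : AffineAlong c l u v) (hc : c ≠ 0) : AffineAlong c⁻¹ l v u := by
  obtain ⟨ε, b, hε, h⟩ := h
  refine ⟨ε, -(ε * c⁻¹ * b), hε, h.mono fun x hx => ?_⟩
  rw [hx]
  rcases hε with rfl | rfl <;> field_simp <;> ring

theorem trans (h : AffineAlong c l u v) (h' : AffineAlong d l v w) :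
    AffineAlong (c * d) l u w := by
  obtain ⟨ε, b, hε, h⟩ := h
  obtain ⟨ε', b', hε', h'⟩ := h'
  refine ⟨ε * ε', ε * c * b' + b, ?_, (h.and h').mono fun x hx => ?_⟩
  · rcases hε with rfl | rfl <;> rcases hε' with rfl | rfl <;> simp
  · rw [hx.1, hx.2]; ring

theorem comp (h : AffineAlong c l u v) {l' : Filter Y} {g : Y → X} (hg : Filter.Tendsto g l' l) :
    AffineAlong c l' (fun y => u (g y)) (fun y => v (g y)) := by
  obtain ⟨ε, b, hε, h⟩ := h
  exact ⟨ε, b, hε, hg.eventually h⟩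

theorem congr (h : AffineAlong c l u v) {u' v' : X → ℝ} (hu : u =ᶠ[l] u') (hv : v =ᶠ[l] v') :
    AffineAlong c l u' v' := by
  obtain ⟨ε, b, hε, h⟩ := h
  refine ⟨ε, b, hε, ?_⟩
  filter_upwards [h, hu, hv] with x h1 h2 h3
  rw [← h2, ← h3, h1]

end AffineAlong

section

variable {X Y Z : Type*} [TopologicalSpace X] [TopologicalSpace Y] [TopologicalSpace Z]

theorem measuredCompatible_iff {φ ψ : OpenPartialHomeomorph X (ℝ × ℝ)} :
    MeasuredCompatible φ ψ ↔ ∀ x ∈ φ.source ∩ ψ.source,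
      AffineAlong 1 (𝓝 x) (fun x' => (φ x').2) (fun x' => (ψ x').2) := by
  simp [MeasuredCompatible, AffineAlong]

namespace SingularMeasuredFoliation

variable {F F' G G' : SingularMeasuredFoliation X}

theorem affineAlong_charts {φ ψ : OpenPartialHomeomorph X (ℝ × ℝ)} (hφ : φ ∈ F.charts)
    (hψ : ψ ∈ F.charts) {x : X} (hx : x ∈ φ.source) (hx' : x ∈ ψ.source) :
    AffineAlong 1 (𝓝 x) (fun x' => (φ x').2) (fun x' => (ψ x').2) :=
  measuredCompatible_iff.1 (F.compatible φ hφ ψ hψ) x ⟨hx, hx'⟩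

theorem isClosed_sing (F : SingularMeasuredFoliation X) : IsClosed F.sing := by
  rw [← isOpen_compl_iff, isOpen_iff_mem_nhds]
  intro x hx
  obtain ⟨φ, hφ, hxφ⟩ := F.exists_chart x hx
  exact Filter.mem_of_superset (φ.open_source.mem_nhds hxφ) (F.source_subset φ hφ)

/-! ### Calculus of images of foliations: composition, inverses, lifts. -/

namespace HasImage

theorem affineAlong {G : SingularMeasuredFoliation Y} {p : X → Y} {c : ℝ} (h : F.HasImage p c G)
    {φ : OpenPartialHomeomorph X (ℝ × ℝ)} {ψ : OpenPartialHomeomorph Y (ℝ × ℝ)}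
    (hφ : φ ∈ F.charts) (hψ : ψ ∈ G.charts) {x : X} (hx : x ∈ φ.source) (hx' : p x ∈ ψ.source) :
    AffineAlong c (𝓝 x) (fun x' => (φ x').2) (fun x' => (ψ (p x')).2) :=
  h.2 φ hφ ψ hψ x hx hx'

theorem mem_sing_iff {G : SingularMeasuredFoliation Y} {p : X → Y} {c : ℝ} (h : F.HasImage p c G)
    (x : X) : p x ∈ G.sing ↔ x ∈ F.sing := by
  rw [h.1]; rfl

theorem refl (F : SingularMeasuredFoliation X) : F.HasImage id 1 F :=
  ⟨rfl, fun _ hφ _ hψ _ hx hx' => affineAlong_charts hφ hψ hx hx'⟩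

theorem comp {G : SingularMeasuredFoliation Y} {H : SingularMeasuredFoliation Z} {p : X → Y}
    {q : Y → Z} {c d : ℝ} (h : F.HasImage p c G) (h' : G.HasImage q d H) (hp : Continuous p) :
    F.HasImage (q ∘ p) (c * d) H := by
  refine ⟨by rw [h.1, h'.1]; rfl, fun φ hφ ψ hψ x hx hx' => ?_⟩
  have hreg : p x ∉ G.sing := by
    rw [h.mem_sing_iff]; exact F.source_subset φ hφ hx
  obtain ⟨χ, hχ, hxχ⟩ := G.exists_chart _ hreg
  exact (h.affineAlong hφ hχ hx hxχ).trans ((h'.affineAlong hχ hψ hxχ hx').comp hp.continuousAt)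

theorem symm {G : SingularMeasuredFoliation Y} {f : X ≃ₜ Y} {c : ℝ} (h : F.HasImage f c G)
    (hc : c ≠ 0) : G.HasImage f.symm c⁻¹ F := by
  refine ⟨by ext y; rw [Set.mem_preimage, ← h.mem_sing_iff, f.apply_symm_apply],
    fun φ hφ ψ hψ y hy hy' => ?_⟩
  have h1 := h.affineAlong hψ hφ hy' (by simpa using hy)
  have h2 := (h1.comp f.symm.continuous.continuousAt).symm hc
  simpa [AffineAlong] using h2

theorem iterate {p : X → X} {c : ℝ} (h : F.HasImage p c F) (hp : Continuous p) (n : ℕ) :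
    F.HasImage p^[n] (c ^ n) F := by
  induction n with
  | zero => simpa using refl F
  | succ n ih =>
    rw [Function.iterate_succ, pow_succ']
    exact h.comp ih hp

/-- A lift of a map of foliated surfaces maps the lifted foliations in the same way. -/
theorem of_semiconj {H K : SingularMeasuredFoliation Y} {q : X → Y} {f : Y → Y} {ft : X → X} {c : ℝ}
    (hF : F.HasImage q 1 H) (hG : G.HasImage q 1 K) (h : H.HasImage f c K)
    (hq : Continuous q) (hft : Continuous ft) (hs : ∀ x, q (ft x) = f (q x)) :
    F.HasImage ft c G := by
  refine ⟨by rw [hF.1, hG.1, h.1]; ext x; simp [hs], fun φ hφ ψ hψ x hx hx' => ?_⟩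
  have hreg : q x ∉ H.sing := by
    rw [hF.mem_sing_iff]; exact F.source_subset φ hφ hx
  obtain ⟨φ₀, hφ₀, hxφ₀⟩ := H.exists_chart _ hreg
  have hreg' : q (ft x) ∉ K.sing := by
    rw [hG.mem_sing_iff]; exact G.source_subset ψ hψ hx'
  obtain ⟨ψ₀, hψ₀, hxψ₀⟩ := K.exists_chart _ hreg'
  have h1 := hF.affineAlong hφ hφ₀ hx hxφ₀
  have h2 := (h.affineAlong hφ₀ hψ₀ hxφ₀ (by rwa [← hs])).comp hq.continuousAt
  have h3 := ((hG.affineAlong hψ hψ₀ hx' hxψ₀).symm one_ne_zero).comp hft.continuousAt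
  simp only [← hs] at h2
  have h4 := (h1.trans h2).trans h3
  rw [one_mul, inv_one, mul_one] at h4
  exact h4

end HasImage

/-! ### Lifting a foliation along a local homeomorphism -/

/-- The lift of a singular measured foliation along a local homeomorphism. -/
def lift {q : X → Y} (hq : IsLocalHomeomorph q) (F : SingularMeasuredFoliation Y) :
    SingularMeasuredFoliation X :=
  have mem_of {φ : OpenPartialHomeomorph X (ℝ × ℝ)}
      (h : ∀ x ∈ φ.source, ∃ e : OpenPartialHomeomorph X Y, x ∈ e.source ∧ q = e ∧
        e.symm.trans φ ∈ F.charts) :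
      φ.source ⊆ (q ⁻¹' F.sing)ᶜ ∧ ∀ ψ ∈ F.charts, ∀ x ∈ φ.source, q x ∈ ψ.source →
        AffineAlong 1 (𝓝 x) (fun x' => (φ x').2) (fun x' => (ψ (q x')).2) := by
    refine ⟨fun x hx => ?_, fun ψ hψ x hx hx' => ?_⟩ <;> obtain ⟨e, hxe, rfl, he⟩ := h x hx
    · exact F.source_subset _ he (by simp [e.map_source hxe, e.left_inv hxe, hx])
    · have h1 := affineAlong_charts he hψ (x := e x)
        (by simp [e.map_source hxe, e.left_inv hxe, hx]) hx'
      refine (h1.comp (e.continuousAt hxe)).congr ?_ (Filter.EventuallyEq.refl _ _)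
      filter_upwards [e.open_source.mem_nhds hxe] with x' hx'
      simp [e.left_inv hx']
  { sing := q ⁻¹' F.sing
    -- The atlas consists of all charts that agree with the pulled-back charts, not of the
    -- pull-backs alone; maximality then only requires testing against pull-backs `e.trans ψ`.
    charts := {φ | φ.source ⊆ (q ⁻¹' F.sing)ᶜ ∧ ∀ ψ ∈ F.charts, ∀ x ∈ φ.source, q x ∈ ψ.source →
      AffineAlong 1 (𝓝 x) (fun x' => (φ x').2) (fun x' => (ψ (q x')).2)}
    source_subset := fun φ hφ => hφ.1
    exists_chart := by
      intro x hx
      obtain ⟨ψ, hψ, hxψ⟩ := F.exists_chart (q x) hx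
      obtain ⟨e, hxe, rfl⟩ := hq x
      refine ⟨e.trans ψ, ⟨fun x hx => ?_, fun ψ' hψ' x hx hx' => ?_⟩, by simp [hxe, hxψ]⟩
      · simp only [OpenPartialHomeomorph.trans_source, Set.mem_inter_iff, Set.mem_preimage] at hx
        exact F.source_subset ψ hψ hx.2
      · simp only [OpenPartialHomeomorph.trans_source, Set.mem_inter_iff, Set.mem_preimage] at hx
        exact (affineAlong_charts hψ hψ' hx.2 hx').comp (e.continuousAt hx.1)
    compatible := by
      intro φ hφ ψ hψ
      rw [measuredCompatible_iff]
      rintro x ⟨hx, hx'⟩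
      obtain ⟨χ, hχ, hxχ⟩ := F.exists_chart (q x) (hφ.1 hx)
      simpa using (hφ.2 χ hχ x hx hxχ).trans ((hψ.2 χ hχ x hx' hxχ).symm one_ne_zero)
    maximal := by
      intro φ hφ h
      refine ⟨hφ, fun ψ hψ x hx hx' => ?_⟩
      obtain ⟨e, hxe, rfl⟩ := hq x
      have he : e.trans ψ ∈ {φ : OpenPartialHomeomorph X (ℝ × ℝ) | φ.source ⊆ (e ⁻¹' F.sing)ᶜ ∧
          ∀ ψ ∈ F.charts, ∀ x ∈ φ.source, e x ∈ ψ.source →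
          AffineAlong 1 (𝓝 x) (fun x' => (φ x').2) (fun x' => (ψ (e x')).2)} := by
        refine ⟨fun x hx => ?_, fun ψ' hψ' x hx hx' => ?_⟩
        · simp only [OpenPartialHomeomorph.trans_source, Set.mem_inter_iff, Set.mem_preimage] at hx
          exact F.source_subset ψ hψ hx.2
        · simp only [OpenPartialHomeomorph.trans_source, Set.mem_inter_iff, Set.mem_preimage] at hx
          exact (affineAlong_charts hψ hψ' hx.2 hx').comp (e.continuousAt hx.1)
      exact measuredCompatible_iff.1 (h _ he) x ⟨hx, by simp [hxe, hx']⟩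
    exists_prong := by
      intro p hp
      obtain ⟨k, hk, ζ, hpζ, hζp, hζ⟩ := F.exists_prong (q p) hp
      obtain ⟨e, hpe, rfl⟩ := hq p
      refine ⟨k, hk, e.trans ζ, by simp [hpe, hpζ], by simp [hζp], fun φ hφ => mem_of ?_⟩
      intro x hx
      have hx1 := hφ.1 hx
      simp only [OpenPartialHomeomorph.trans_source, Set.mem_sdiff, Set.mem_inter_iff,
        Set.mem_preimage] at hx1
      -- Pushed down by a local inverse of `q`, a branch around `p` becomes a branch around `q p`,
      -- and these are charts of `F`.
      refine ⟨e, hx1.1.1, rfl, hζ _ ⟨?_, ?_⟩⟩ <;> intro y hy <;>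
      simp only [OpenPartialHomeomorph.trans_source, OpenPartialHomeomorph.symm_source,
        Set.mem_inter_iff, Set.mem_preimage] at hy
      · have := hφ.1 hy.2
        simp only [OpenPartialHomeomorph.trans_source, Set.mem_sdiff, Set.mem_inter_iff,
          Set.mem_preimage, e.right_inv hy.1, Set.mem_singleton_iff] at this
        refine ⟨this.1.2, ?_⟩
        rintro rfl
        exact this.2 (e.left_inv hpe)
      · have := hφ.2 _ hy.2
        simpa [e.right_inv hy.1] using this }

theorem hasImage_lift {q : X → Y} (hq : IsLocalHomeomorph q) (F : SingularMeasuredFoliation Y) :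
    (F.lift hq).HasImage q 1 F :=
  ⟨rfl, fun _ hφ ψ hψ x hx hx' => hφ.2 ψ hψ x hx hx'⟩

/-- A chart that is locally the pull-back of a chart downstairs is a chart of the lift. -/
theorem mem_lift_charts {q : X → Y} (hq : IsLocalHomeomorph q) {F : SingularMeasuredFoliation Y}
    {φ : OpenPartialHomeomorph X (ℝ × ℝ)}
    (h : ∀ x ∈ φ.source, ∃ e : OpenPartialHomeomorph X Y, x ∈ e.source ∧ q = e ∧
      e.symm.trans φ ∈ F.charts) : φ ∈ (F.lift hq).charts := by
  refine ⟨fun x hx => ?_, fun ψ hψ x hx hx' => ?_⟩ <;> obtain ⟨e, hxe, rfl, he⟩ := h x hx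
  · exact F.source_subset _ he (by simp [e.map_source hxe, e.left_inv hxe, hx])
  · have h1 := affineAlong_charts he hψ (x := e x)
      (by simp [e.map_source hxe, e.left_inv hxe, hx]) hx'
    refine (h1.comp (e.continuousAt hxe)).congr ?_ (Filter.EventuallyEq.refl _ _)
    filter_upwards [e.open_source.mem_nhds hxe] with x' hx'
    simp [e.left_inv hx']

theorem trans_mem_lift_charts {q : X → Y} (hq : IsLocalHomeomorph q)
    {F : SingularMeasuredFoliation Y} {ψ : OpenPartialHomeomorph Y (ℝ × ℝ)} (hψ : ψ ∈ F.charts)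
    {e : OpenPartialHomeomorph X Y} (he : q = e) : e.trans ψ ∈ (F.lift hq).charts := by
  subst he
  refine ⟨fun x hx => ?_, fun ψ' hψ' x hx hx' => ?_⟩ <;>
  simp only [OpenPartialHomeomorph.trans_source, Set.mem_inter_iff, Set.mem_preimage] at hx
  · exact F.source_subset ψ hψ hx.2
  · exact (affineAlong_charts hψ hψ' hx.2 hx').comp (e.continuousAt hx.1)

theorem Transverse.lift {q : X → Y} (hq : IsLocalHomeomorph q) {F G : SingularMeasuredFoliation Y}
    (h : F.Transverse G) : (F.lift hq).Transverse (G.lift hq) where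
  sing_eq := congrArg (q ⁻¹' ·) h.sing_eq
  regular := by
    intro x hx
    obtain ⟨φ, hφ, hxφ, hφ'⟩ := h.regular (q x) hx
    obtain ⟨e, hxe, he⟩ := hq x
    refine ⟨e.trans φ, trans_mem_lift_charts hq hφ he, by simp [hxe, ← he, hxφ], ?_⟩
    rw [OpenPartialHomeomorph.trans_transHomeomorph]
    exact trans_mem_lift_charts hq hφ' he
  singular := by
    intro p hp
    obtain ⟨k, hk, ζ, hpζ, hζp, hζ⟩ := h.singular (q p) hp
    obtain ⟨e, hpe, he⟩ := hq p
    rw [he] at hpζ hζp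
    refine ⟨k, hk, e.trans ζ, by simp [hpe, hpζ], by simp [hζp], fun φ hφ => ?_⟩
    have key : IsProngBranch ζ (q p) k (e.symm.trans φ) := by
      refine ⟨?_, ?_⟩ <;> intro y hy <;>
      simp only [OpenPartialHomeomorph.trans_source, OpenPartialHomeomorph.symm_source,
        Set.mem_inter_iff, Set.mem_preimage] at hy
      · have := hφ.1 hy.2
        simp only [OpenPartialHomeomorph.trans_source, Set.mem_sdiff, Set.mem_inter_iff,
          Set.mem_preimage, e.right_inv hy.1, Set.mem_singleton_iff] at this
        refine ⟨this.1.2, ?_⟩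
        rintro rfl
        exact this.2 (by rw [he]; exact e.left_inv hpe)
      · have := hφ.2 _ hy.2
        simpa [e.right_inv hy.1] using this
    have hsrc : ∀ x ∈ φ.source, x ∈ e.source := by
      intro x hx
      have hx1 := hφ.1 hx
      simp only [OpenPartialHomeomorph.trans_source, Set.mem_sdiff, Set.mem_inter_iff,
        Set.mem_preimage] at hx1
      exact hx1.1.1
    obtain ⟨h1, h2⟩ := hζ _ key
    refine ⟨mem_lift_charts hq fun x hx => ⟨e, hsrc x hx, he, h1⟩,
      mem_lift_charts hq fun x hx => ⟨e, hsrc x hx, he, ?_⟩⟩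
    rwa [← OpenPartialHomeomorph.trans_transHomeomorph]

/-- Transversality is symmetric: the prong chart has to be replaced by its rotated conjugate. -/
theorem Transverse.symm (h : F.Transverse G) : G.Transverse F where
  sing_eq := h.sing_eq.symm
  regular := by
    intro x hx
    rw [← h.sing_eq] at hx
    obtain ⟨φ, hφ, hxφ, hφ'⟩ := h.regular x hx
    refine ⟨_, hφ', hxφ, ?_⟩
    rw [OpenPartialHomeomorph.transHomeomorph_transHomeomorph]
    convert hφ
    ext <;> simp
  singular := by
    intro p hp
    rw [← h.sing_eq] at hp
    obtain ⟨k, hk, ζ, hpζ, hζp, hζ⟩ := h.singular p hp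
    have hk0 : (k : ℂ) ≠ 0 := by exact_mod_cast (by omega : k ≠ 0)
    -- With `ω ^ k = -1`, the chart `ω * conj ζ` has `k`-th power `-conj (ζ ^ k)`. If `w ^ 2 = ζ ^
    -- k`, a square root of this is `i * conj w`, which is `w` with real and imaginary parts
    -- exchanged.
    set ω : ℂ := Complex.exp (Real.pi * Complex.I / k) with hω
    have hω0 : ω ≠ 0 := Complex.exp_ne_zero _
    have hωk : ω ^ k = -1 := by
      rw [hω, ← Complex.exp_nat_mul, mul_div_cancel₀ _ hk0, Complex.exp_pi_mul_I]
    let r : ℂ ≃ₜ ℂ := Complex.conjCLE.toHomeomorph.trans (Homeomorph.mulLeft₀ ω hω0)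
    have hr : ∀ z, r z = ω * (starRingEnd ℂ) z := fun z => rfl
    refine ⟨k, hk, ζ.transHomeomorph r, hpζ, by simp [hr, hζp], fun φ hφ => ?_⟩
    have key : IsProngBranch ζ p k (φ.transHomeomorph (Homeomorph.prodComm ℝ ℝ)) := by
      refine ⟨hφ.1, fun x hx => ?_⟩
      have h1 := hφ.2 x hx
      simp only [OpenPartialHomeomorph.transHomeomorph_apply, Function.comp_apply, hr, mul_pow,
        hωk] at h1
      have h2 : ζ x ^ k = -(starRingEnd ℂ) ((⟨(φ x).1, (φ x).2⟩ : ℂ) ^ 2) := by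
        rw [h1]; simp
      rw [h2]
      apply Complex.ext <;> simp [pow_two]
    obtain ⟨h1, h2⟩ := hζ _ key
    refine ⟨?_, h1⟩
    rw [OpenPartialHomeomorph.transHomeomorph_transHomeomorph] at h2
    convert h2
    ext <;> simp

end SingularMeasuredFoliation

end

/-! ### Local branches of `ζ ^ (k / 2)` and isolated singularities -/

section

variable {X : Type*} [TopologicalSpace X]

/-- Away from the centre of a complex chart, `ζ ^ (k / 2)` has local branches that are charts. -/
theorem exists_isProngBranch {ζ : OpenPartialHomeomorph X ℂ} {p x : X} {k : ℕ} (hk : k ≠ 0)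
    (hζp : ζ p = 0) (hx : x ∈ ζ.source) (hx0 : ζ x ≠ 0) :
    ∃ φ, IsProngBranch ζ p k φ ∧ x ∈ φ.source := by
  set z₀ := ζ x
  have hk' : (k : ℂ) ≠ 0 := by exact_mod_cast hk
  let w : ℂ := Complex.exp (k / 2 * Complex.log z₀)
  have hw : w ^ 2 = z₀ ^ k := by
    rw [← Complex.exp_nat_mul, ← Complex.exp_log hx0, ← Complex.exp_nat_mul, Complex.log_exp]
    · congr 1; push_cast; ring
    · exact Complex.neg_pi_lt_log_im _
    · exact Complex.log_im_le_pi _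
  -- Dividing by `z₀` moves the base point to `1`, off the cut of the principal logarithm, so `R` is
  -- differentiable there and the inverse function theorem applies.
  let R : ℂ → ℂ := fun z => w * Complex.exp (k / 2 * Complex.log (z / z₀))
  have hR : ∀ z, z ≠ 0 → R z ^ 2 = z ^ k := by
    intro z hz
    have h1 : Complex.exp (k / 2 * Complex.log (z / z₀)) ^ 2 = (z / z₀) ^ k := by
      rw [← Complex.exp_nat_mul]
      conv_rhs => rw [← Complex.exp_log (div_ne_zero hz hx0), ← Complex.exp_nat_mul]
      congr 1; push_cast; ring
    rw [mul_pow, hw, h1, div_pow]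
    field_simp
  have hd : HasStrictDerivAt R
      (w * (Complex.exp (k / 2 * Complex.log (z₀ / z₀)) * (k / 2 * (1 / z₀ / (z₀ / z₀))))) z₀ :=
    (((((hasStrictDerivAt_id z₀).div_const z₀).clog
      (by simp [div_self hx0])).const_mul _).cexp).const_mul w
  have hne : w * (Complex.exp (k / 2 * Complex.log (z₀ / z₀)) * (k / 2 * (1 / z₀ / (z₀ / z₀)))) ≠ 0 := by
    rw [div_self hx0]
    simp [hk, hx0, w]
  have hs := hd.hasStrictFDerivAt_equiv hne
  -- The identity `R z ^ 2 = z ^ k` holds even across the cut; only `z = 0` has to be removed.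
  let e := (hs.toOpenPartialHomeomorph R).restrOpen {0}ᶜ isOpen_compl_singleton
  have he : ∀ z, e z = R z := fun z => rfl
  have hez : z₀ ∈ e.source := ⟨hs.mem_toOpenPartialHomeomorph_source, hx0⟩
  refine ⟨(ζ.trans e).transHomeomorph Complex.equivRealProdCLM.toHomeomorph, ⟨?_, ?_⟩, ?_⟩
  · intro y hy
    have hy' : y ∈ ζ.source ∧ ζ y ∈ e.source := by simpa using hy
    refine ⟨hy'.1, ?_⟩
    rintro rfl
    exact hy'.2.2 hζp
  · intro y hy
    have hy' : y ∈ ζ.source ∧ ζ y ∈ e.source := by simpa using hy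
    have := hR (ζ y) hy'.2.2
    rw [← this]
    rfl
  · have : x ∈ ζ.source ∧ ζ x ∈ e.source := ⟨hx, hez⟩
    simpa using this

theorem chart_apply_ne_zero {ζ : OpenPartialHomeomorph X ℂ} {p x : X} (hp : p ∈ ζ.source)
    (hζp : ζ p = 0) (hx : x ∈ ζ.source) (hxp : x ≠ p) : ζ x ≠ 0 :=
  fun h => hxp (ζ.injOn hx hp (h.trans hζp.symm))

namespace SingularMeasuredFoliation

variable {F : SingularMeasuredFoliation X}

/-- Isolation of singularities comes for free: every other point of a prong chart lies on a branch
of `ζ ^ (k / 2)`, which is a natural chart, and natural charts avoid the singularities. -/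
theorem notMem_sing_of_prong {ζ : OpenPartialHomeomorph X ℂ} {p x : X} {k : ℕ} (hk : k ≠ 0)
    (hp : p ∈ ζ.source) (hζp : ζ p = 0) (hζ : ∀ φ, IsProngBranch ζ p k φ → φ ∈ F.charts)
    (hx : x ∈ ζ.source) (hxp : x ≠ p) : x ∉ F.sing := by
  obtain ⟨φ, hφ, hxφ⟩ := exists_isProngBranch hk hζp hx (chart_apply_ne_zero hp hζp hx hxp)
  exact F.source_subset φ (hζ φ hφ) hxφ

theorem exists_nhds_inter_sing (F : SingularMeasuredFoliation X) {p : X} (hp : p ∈ F.sing) :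
    ∃ U ∈ 𝓝 p, U ∩ F.sing = {p} := by
  obtain ⟨k, hk, ζ, hpζ, hζp, hζ⟩ := F.exists_prong p hp
  refine ⟨ζ.source, ζ.open_source.mem_nhds hpζ, ?_⟩
  ext x
  constructor
  · rintro ⟨hx, hx'⟩
    by_contra hxp
    exact notMem_sing_of_prong (by omega) hpζ hζp hζ hx hxp hx'
  · rintro rfl
    exact ⟨hpζ, hp⟩

theorem hasCountablyInfiniteIsolatedSing [SecondCountableTopology X] (F : SingularMeasuredFoliation X)
    (h : F.sing.Infinite) : F.HasCountablyInfiniteIsolatedSing where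
  countable := by
    have : DiscreteTopology F.sing := by
      rw [discreteTopology_subtype_iff']
      intro p hp
      obtain ⟨U, hU, hUp⟩ := F.exists_nhds_inter_sing hp
      obtain ⟨V, hVU, hV, hpV⟩ := mem_nhds_iff.1 hU
      refine ⟨V, hV, subset_antisymm ?_ ?_⟩
      · rw [← hUp]; gcongr
      · rintro _ rfl; exact ⟨hpV, hp⟩
    exact Set.countable_coe_iff.1 (TopologicalSpace.separableSpace_iff_countable.1 inferInstance)
  infinite := h
  isolated := fun _ hp => F.exists_nhds_inter_sing hp
  closed := F.isClosed_sing

end SingularMeasuredFoliation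

end

/-! ### Short loops in leaves do not exist -/

/-- The mean of the values at `0` and `1 / 2` is attained on both halves of the interval. All
statements that short leaf paths do not close up are reduced to this one-dimensional fact. -/
theorem not_injOn_Ico_of_eq {f : unitInterval → ℝ} (hf : Continuous f) (h : f 0 = f 1) :
    ¬ Set.InjOn f (Set.Ico 0 1) := by
  intro hinj
  let c : unitInterval := ⟨1 / 2, by norm_num, by norm_num⟩
  have hc0 : (0 : unitInterval) < c := by
    rw [← Subtype.coe_lt_coe]; norm_num [c]
  have hc1 : c < 1 := by
    rw [← Subtype.coe_lt_coe]; norm_num [c]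
  have hne : f 0 ≠ f c := fun h0 =>
    hc0.ne (hinj ⟨le_rfl, zero_lt_one⟩ ⟨hc0.le, hc1⟩ h0)
  have hm : (f 0 + f c) / 2 ∈ Set.uIcc (f 0) (f c) := by
    rw [Set.mem_uIcc]
    rcases le_total (f 0) (f c) with h1 | h1
    · left; constructor <;> linarith
    · right; constructor <;> linarith
  obtain ⟨s, hs, hs'⟩ := intermediate_value_uIcc (f := f) (a := 0) (b := c) hf.continuousOn hm
  obtain ⟨t, ht, ht'⟩ := intermediate_value_uIcc (f := f) (a := 1) (b := c) hf.continuousOn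
    (h ▸ hm)
  rw [Set.uIcc_of_le hc0.le] at hs
  rw [Set.uIcc_of_ge hc1.le] at ht
  have ht1 : t ≠ 1 := by
    rintro rfl
    exact hne (by linarith)
  have hst := hinj ⟨hs.1, hs.2.trans_lt hc1⟩ ⟨hc0.le.trans ht.1, lt_of_le_of_ne ht.2 ht1⟩
    (by rw [hs', ht', h])
  subst hst
  have : s = c := le_antisymm hs.2 ht.1
  subst this
  exact hne (by linarith)

/-- A non-zero level set is open and closed. The point is that nothing is assumed at the zeros of
`Q`: the definition of a leaf path imposes no condition at the singularities. -/
theorem eq_of_eventually_eq_of_ne_zero {T : Type*} [TopologicalSpace T] [PreconnectedSpace T]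
    {Q : T → ℝ} (hQ : Continuous Q) (h : ∀ u, Q u ≠ 0 → ∀ᶠ s in 𝓝 u, Q s = Q u) (u v : T) :
    Q u = Q v := by
  by_cases h0 : ∀ u, Q u = 0
  · rw [h0, h0]
  push Not at h0
  obtain ⟨w, hw⟩ := h0
  have hclopen : IsClopen {s | Q s = Q w} := by
    refine ⟨isClosed_eq hQ continuous_const, isOpen_iff_mem_nhds.2 fun s hs => ?_⟩
    have hs' : Q s = Q w := hs
    filter_upwards [h s (by rwa [hs'])] with s' h'
    exact h'.trans hs'
  have huniv := hclopen.eq_univ ⟨w, rfl⟩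
  have key : ∀ s, Q s = Q w := fun s => by
    have : s ∈ {s | Q s = Q w} := huniv ▸ Set.mem_univ s
    exact this
  rw [key u, key v]

/-- The quotient `Z / r` is continuous with values in the finite set of `k`-th roots of unity. -/
theorem exists_eq_mul_of_pow_eq_pow {T : Type*} [TopologicalSpace T] {S : Set T}
    (hS : IsPreconnected S) {Z r : T → ℂ} {k : ℕ} (hk : 0 < k) (hZ : ContinuousOn Z S)
    (hr : ContinuousOn r S) (h : ∀ t ∈ S, Z t ^ k = r t ^ k) (h0 : ∀ t ∈ S, r t ≠ 0) :
    ∃ ω : ℂ, ∀ t ∈ S, Z t = ω * r t := by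
  rcases S.eq_empty_or_nonempty with rfl | ⟨t₀, ht₀⟩
  · exact ⟨0, fun t ht => ht.elim⟩
  have hfin : {z : ℂ | z ^ k = 1}.Finite :=
    ((Polynomial.nthRoots k (1 : ℂ)).toFinset.finite_toSet).subset fun z hz => by
      simpa [Polynomial.mem_nthRoots hk] using hz
  refine ⟨Z t₀ / r t₀, fun t ht => ?_⟩
  have := hS.constant_of_mapsTo hfin.isDiscrete (hZ.div hr h0)
    (fun t ht => by
      change (Z t / r t) ^ k = 1
      rw [div_pow, h t ht, div_self (pow_ne_zero _ (h0 t ht))]) ht₀ ht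
  simp only [Pi.div_apply] at this
  rw [this, div_mul_cancel₀ _ (h0 t ht)]

theorem exists_pow_eq_neg_one {k : ℕ} (hk : k ≠ 0) : ∃ ω : ℂ, ω ^ k = -1 := by
  refine ⟨(-1 : ℂ) ^ ((k : ℂ)⁻¹), Complex.cpow_nat_inv_pow _ hk⟩

/-- A closed curve in the plane on which `Im (Z ^ (k / 2))` is locally constant up to sign cannot be
injective. -/
theorem not_injOn_Ico_of_prong {Z : unitInterval → ℂ} (hZ : Continuous Z) {k : ℕ} (hk : k ≠ 0)
    (hQ : ∀ u v, ‖Z u ^ k‖ - (Z u ^ k).re = ‖Z v ^ k‖ - (Z v ^ k).re) (h : Z 0 = Z 1) :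
    ¬ Set.InjOn Z (Set.Ico 0 1) := by
  intro hinj
  have h01 : (0 : unitInterval) < 1 := zero_lt_one
  have h0mem : (0 : unitInterval) ∈ Set.Ico (0 : unitInterval) 1 := ⟨le_rfl, h01⟩
  -- The constant is `2 Im(Z ^ (k / 2)) ^ 2`. If it vanishes, `Z ^ k ≥ 0` and the curve runs on the
  -- `k` rays issuing from the origin.
  by_cases hq : ‖Z 0 ^ k‖ - (Z 0 ^ k).re = 0
  · have hpow : ∀ t, Z t ^ k = (‖Z t‖ : ℂ) ^ k := by
      intro t
      have h1 := (hQ t 0).trans hq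
      have h2 : (Z t ^ k).im = 0 := by
        have := Complex.sq_norm (Z t ^ k)
        rw [Complex.normSq_apply] at this
        have h3 : ‖Z t ^ k‖ = (Z t ^ k).re := by linarith
        rw [h3] at this
        nlinarith
      rw [← Complex.ofReal_pow, ← norm_pow]
      apply Complex.ext
      · rw [Complex.ofReal_re]; linarith
      · rw [Complex.ofReal_im, h2]
    have hnc : Continuous fun t => (‖Z t‖ : ℂ) := by fun_prop
    have branch : ∀ S : Set unitInterval, IsPreconnected S → (∀ t ∈ S, Z t ≠ 0) →
        ∃ ω : ℂ, ∀ t ∈ S, Z t = ω * ‖Z t‖ := fun S hS hS0 =>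
      exists_eq_mul_of_pow_eq_pow hS (Nat.pos_of_ne_zero hk) hZ.continuousOn hnc.continuousOn
        (fun t _ => hpow t) (fun t ht => by simpa using hS0 t ht)
    -- The whole curve lies on one ray: by injectivity it passes through the origin at most once
    -- before time `1`, and the rays before and after this passage agree because `Z 0 = Z 1`. Then
    -- `‖Z‖` is a closed injective real curve.
    have key : ∃ ω : ℂ, ∀ t, Z t = ω * ‖Z t‖ := by
      by_cases hz : ∃ t₀ ∈ Set.Ico (0 : unitInterval) 1, Z t₀ = 0
      · obtain ⟨t₀, ht₀, hzt⟩ := hz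
        rcases ht₀.1.eq_or_lt with rfl | hpos
        · obtain ⟨ω, hω⟩ := branch (Set.Ioo 0 1) isPreconnected_Ioo fun t ht htz =>
            ht.1.ne (hinj h0mem ⟨ht.1.le, ht.2⟩ (hzt.trans htz.symm))
          refine ⟨ω, fun t => ?_⟩
          by_cases ht : Z t = 0
          · simp [ht]
          · refine hω t ⟨lt_of_le_of_ne t.2.1 ?_, lt_of_le_of_ne t.2.2 ?_⟩
            · intro h'
              apply ht
              rw [← hzt]
              rw [h']
            · intro h'
              apply ht
              rw [← hzt, h, h']
        · have hz0 : Z 0 ≠ 0 := fun h' => hpos.ne (hinj h0mem ht₀ (h'.trans hzt.symm))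
          obtain ⟨ω₁, hω₁⟩ := branch (Set.Ico 0 t₀) isPreconnected_Ico fun t ht htz =>
            ht.2.ne (hinj ⟨ht.1, ht.2.trans ht₀.2⟩ ht₀ (htz.trans hzt.symm))
          obtain ⟨ω₂, hω₂⟩ := branch (Set.Ioc t₀ 1) isPreconnected_Ioc fun t ht htz => by
            rcases ht.2.eq_or_lt with rfl | h1
            · exact hz0 (h.trans htz)
            · exact ht.1.ne (hinj ht₀ ⟨ht₀.1.trans ht.1.le, h1⟩ (hzt.trans htz.symm))
          have e1 := hω₁ 0 ⟨le_rfl, hpos⟩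
          have e2 := hω₂ 1 ⟨ht₀.2, le_rfl⟩
          have heq : ω₁ = ω₂ := by
            rw [← h, e1] at e2
            rw [← e1] at e2
            have h3 : (‖Z 0‖ : ℂ) ≠ 0 := by simpa using hz0
            exact mul_right_cancel₀ h3 (e1.symm.trans e2)
          refine ⟨ω₁, fun t => ?_⟩
          rcases lt_trichotomy t t₀ with h1 | rfl | h1
          · exact hω₁ t ⟨t.2.1, h1⟩
          · simp [hzt]
          · exact heq ▸ hω₂ t ⟨h1, t.2.2⟩
      · push Not at hz
        obtain ⟨ω, hω⟩ := branch Set.univ isPreconnected_univ fun t _ => by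
          by_cases h1 : t = 1
          · rw [h1, ← h]; exact hz 0 h0mem
          · exact hz t ⟨t.2.1, lt_of_le_of_ne t.2.2 h1⟩
        exact ⟨ω, fun t => hω t trivial⟩
    obtain ⟨ω, hω⟩ := key
    refine not_injOn_Ico_of_eq (f := fun t => ‖Z t‖) (by fun_prop) (by simp [h]) ?_
    intro s hs t ht hst
    refine hinj hs ht ?_
    rw [hω s, hω t]
    simp only at hst
    rw [hst]
  -- Here `Z ^ k` avoids the ray `[0, ∞)`, so one branch of the `k`-th root recovers `Z` from `Z ^
  -- k`. The latter runs on the parabola `‖w‖ - Re w = q`, which is parametrised by `Im w`.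
  · set q := ‖Z 0 ^ k‖ - (Z 0 ^ k).re with hqdef
    have hqpos : 0 < q := lt_of_le_of_ne (sub_nonneg.2 (Complex.re_le_norm _)) (Ne.symm hq)
    have hslit : ∀ t, -(Z t ^ k) ∈ Complex.slitPlane := by
      intro t
      rw [Complex.mem_slitPlane_iff]
      by_contra hcon
      push Not at hcon
      have h1 : (Z t ^ k).im = 0 := by simpa using hcon.2
      have h2 : 0 ≤ (Z t ^ k).re := by simpa using hcon.1
      have h3 : ‖Z t ^ k‖ = (Z t ^ k).re := by
        rw [← Complex.abs_re_eq_norm.2 h1, abs_of_nonneg h2]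
      have h4 := hQ t 0
      rw [h3] at h4
      linarith
    obtain ⟨ω₀, hω₀⟩ := exists_pow_eq_neg_one hk
    obtain ⟨ω, hω⟩ := exists_eq_mul_of_pow_eq_pow (S := Set.univ) (Z := Z)
      (r := fun t => ω₀ * (-(Z t ^ k)) ^ ((k : ℂ)⁻¹)) (k := k) isPreconnected_univ
      (Nat.pos_of_ne_zero hk) hZ.continuousOn
      (by
        refine (continuous_const.mul ?_).continuousOn
        rw [continuous_iff_continuousAt]
        intro t
        exact ContinuousAt.comp (f := fun t => -(Z t ^ k)) (g := fun z : ℂ => z ^ ((k : ℂ)⁻¹))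
          (continuousAt_cpow_const (hslit t)) (by fun_prop))
      (fun t _ => by rw [mul_pow, hω₀, Complex.cpow_nat_inv_pow _ hk]; ring)
      (fun t _ => by
        refine mul_ne_zero ?_ ?_
        · rintro rfl
          simp [hk] at hω₀
        · rw [Complex.cpow_def_of_ne_zero (Complex.slitPlane_ne_zero (hslit t))]
          exact Complex.exp_ne_zero _)
    refine not_injOn_Ico_of_eq (f := fun t => (Z t ^ k).im) (by fun_prop) (by simp [h]) ?_
    intro s hs t ht hst
    refine hinj hs ht ?_
    have hre : ∀ t, (Z t ^ k).re = ((Z t ^ k).im ^ 2 - q ^ 2) / (2 * q) := by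
      intro t
      have h1 : ‖Z t ^ k‖ = (Z t ^ k).re + q := by linarith [hQ t 0]
      have h2 := Complex.sq_norm (Z t ^ k)
      rw [Complex.normSq_apply, h1] at h2
      field_simp
      nlinarith
    have hst' : (Z s ^ k).im = (Z t ^ k).im := hst
    have hpow : Z s ^ k = Z t ^ k := by
      apply Complex.ext
      · rw [hre s, hre t, hst']
      · exact hst'
    rw [hω s trivial, hω t trivial]
    simp only [hpow]

section

variable {X : Type*} [TopologicalSpace X]

namespace SingularMeasuredFoliation

variable {F : SingularMeasuredFoliation X}

theorem IsLeafPath.continuous_snd_eq {γ : C(unitInterval, X)} (hγ : F.IsLeafPath γ)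
    {φ : OpenPartialHomeomorph X (ℝ × ℝ)} (hφ : φ ∈ F.charts) (h : ∀ t, γ t ∈ φ.source)
    (s t : unitInterval) : (φ (γ s)).2 = (φ (γ t)).2 :=
  isPreconnected_univ.induction₂ (s := Set.univ) (fun s t => (φ (γ s)).2 = (φ (γ t)).2)
    (fun u _ => by
      rw [nhdsWithin_univ]
      exact (hγ u φ hφ (h u)).mono fun v hv => hv.symm)
    (fun _ _ _ _ _ _ h1 h2 => h1.trans h2) (fun _ _ _ _ h1 => h1.symm) trivial trivial

theorem IsLeafPath.ne_of_chart {γ : C(unitInterval, X)} (hγ : F.IsLeafPath γ)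
    (hinj : Set.InjOn γ (Set.Ico 0 1))
    {φ : OpenPartialHomeomorph X (ℝ × ℝ)} (hφ : φ ∈ F.charts) (h : ∀ t, γ t ∈ φ.source) :
    γ 0 ≠ γ 1 := by
  intro h01
  have hc : Continuous fun t => φ (γ t) :=
    φ.continuousOn.comp_continuous γ.continuous h
  refine not_injOn_Ico_of_eq (f := fun t => (φ (γ t)).1) hc.fst (by simp [h01]) ?_
  intro s hs t ht hst
  exact hinj hs ht (φ.injOn (h s) (h t) (Prod.ext hst (hγ.continuous_snd_eq hφ h s t)))

/-- The coordinate `y` of a branch has a sign ambiguity, but this expression for `2 y ^ 2` is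
single-valued and continuous on the whole prong chart, centre included. -/
theorem norm_sub_re_of_isProngBranch {ζ : OpenPartialHomeomorph X ℂ} {p x : X} {k : ℕ}
    {φ : OpenPartialHomeomorph X (ℝ × ℝ)} (hφ : IsProngBranch ζ p k φ) (hx : x ∈ φ.source) :
    ‖ζ x ^ k‖ - (ζ x ^ k).re = 2 * (φ x).2 ^ 2 := by
  rw [← hφ.2 x hx, norm_pow, Complex.sq_norm, Complex.normSq_apply]
  simp [pow_two]
  ring

theorem IsLeafPath.ne_of_prong {γ : C(unitInterval, X)} (hγ : F.IsLeafPath γ)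
    (hinj : Set.InjOn γ (Set.Ico 0 1)) {ζ : OpenPartialHomeomorph X ℂ} {p : X} {k : ℕ}
    (hk : k ≠ 0) (hζp : ζ p = 0)
    (hζ : ∀ φ, IsProngBranch ζ p k φ → φ ∈ F.charts) (h : ∀ t, γ t ∈ ζ.source) :
    γ 0 ≠ γ 1 := by
  intro h01
  have hZ : Continuous fun t => ζ (γ t) := ζ.continuousOn.comp_continuous γ.continuous h
  refine not_injOn_Ico_of_prong hZ hk ?_ (by simp [h01])
    (fun s hs t ht hst => hinj hs ht (ζ.injOn (h s) (h t) hst))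
  refine eq_of_eventually_eq_of_ne_zero (Q := fun u => ‖ζ (γ u) ^ k‖ - (ζ (γ u) ^ k).re)
    ((hZ.pow k).norm.sub (Complex.continuous_re.comp (hZ.pow k))) fun u hu => ?_
  have hu0 : ζ (γ u) ≠ 0 := by
    intro h0
    simp [h0, hk] at hu
  obtain ⟨φ, hφ, huφ⟩ := exists_isProngBranch (k := k) hk hζp (h u) hu0
  filter_upwards [hγ u φ (hζ φ hφ) huφ,
    γ.continuous.continuousAt (φ.open_source.mem_nhds huφ)] with s hs hs'
  rw [norm_sub_re_of_isProngBranch hφ hs', norm_sub_re_of_isProngBranch hφ huφ, hs]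

/-- The part of a path from time `a` on, reparametrised to the unit interval. -/
def _root_.ContinuousMap.tail (γ : C(unitInterval, X)) (a : unitInterval) : C(unitInterval, X) :=
  γ.comp ⟨fun s => ⟨a + s * (1 - a), by
    have := a.2.1; have := a.2.2; have := s.2.1; have := s.2.2
    constructor <;> nlinarith [mul_nonneg s.2.1 (sub_nonneg.2 a.2.2)]⟩, by fun_prop⟩

theorem IsLeafPath.tail {γ : C(unitInterval, X)} (hγ : F.IsLeafPath γ) (a : unitInterval) :
    F.IsLeafPath (γ.tail a) := by
  intro t φ hφ ht
  exact (ContinuousMap.continuous _).continuousAt.eventually (hγ _ φ hφ ht)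

theorem tail_injOn {γ : C(unitInterval, X)} (hinj : Set.InjOn γ (Set.Ico 0 1)) {a : unitInterval}
    (ha : a < 1) : Set.InjOn (γ.tail a) (Set.Ico 0 1) := by
  have ha' : (a : ℝ) < 1 := ha
  intro s hs t ht hst
  have hs1 : (s : ℝ) < 1 := hs.2
  have ht1 : (t : ℝ) < 1 := ht.2
  have := hinj ⟨unitInterval.nonneg', ?_⟩ ⟨unitInterval.nonneg', ?_⟩ hst
  · have h1 := congrArg Subtype.val this
    simp only [ContinuousMap.coe_mk] at h1
    have h2 : (s : ℝ) * (1 - a) = t * (1 - a) := by linarith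
    exact Subtype.ext (mul_right_cancel₀ (by linarith : (1 - (a : ℝ)) ≠ 0) h2)
  · rw [← Subtype.coe_lt_coe]
    simp only [ContinuousMap.coe_mk, Set.Icc.coe_one]
    nlinarith
  · rw [← Subtype.coe_lt_coe]
    simp only [ContinuousMap.coe_mk, Set.Icc.coe_one]
    nlinarith

/-- Every point has a neighbourhood in which no path in a leaf without self-intersections closes up or
meets two singularities. -/
theorem exists_nhds_leafPath (F : SingularMeasuredFoliation X) (q : X) :
    ∃ V ∈ 𝓝 q, ∀ γ : C(unitInterval, X), F.IsLeafPath γ → Set.InjOn γ (Set.Ico 0 1) →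
      (∀ t, γ t ∈ V) → γ 0 ≠ γ 1 ∧ (γ ⁻¹' F.sing).Subsingleton := by
  suffices h : ∃ V ∈ 𝓝 q, (V ∩ F.sing).Subsingleton ∧
      ∀ γ : C(unitInterval, X), F.IsLeafPath γ → Set.InjOn γ (Set.Ico 0 1) →
      (∀ t, γ t ∈ V) → γ 0 ≠ γ 1 by
    obtain ⟨V, hV, hV1, hV2⟩ := h
    refine ⟨V, hV, fun γ hγ hinj hγV => ⟨hV2 γ hγ hinj hγV, ?_⟩⟩
    -- There is at most one singularity in `V`, so two visits to singularities are visits to the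
    -- same point; injectivity puts the second at time `1`, and the part of the path from `s` on
    -- closes up.
    have key : ∀ s t, s < t → γ s ∈ F.sing → γ t ∈ F.sing → False := by
      intro s t hst hs ht
      have heq := hV1 ⟨hγV s, hs⟩ ⟨hγV t, ht⟩
      have hs1 : s < 1 := hst.trans_le unitInterval.le_one'
      by_cases ht1 : t < 1
      · exact hst.ne (hinj ⟨unitInterval.nonneg', hs1⟩ ⟨unitInterval.nonneg', ht1⟩ heq)
      · have : t = 1 := le_antisymm unitInterval.le_one' (not_lt.1 ht1)
        subst this
        refine hV2 _ (hγ.tail s) (tail_injOn hinj hs1) (fun u => hγV _) ?_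
        simpa [ContinuousMap.tail] using heq
    intro s hs t ht
    by_contra hne
    rcases lt_or_gt_of_ne hne with h1 | h1
    · exact key s t h1 hs ht
    · exact key t s h1 ht hs
  by_cases hq : q ∈ F.sing
  · obtain ⟨k, hk, ζ, hpζ, hζp, hζ⟩ := F.exists_prong q hq
    refine ⟨ζ.source, ζ.open_source.mem_nhds hpζ, ?_, fun γ hγ hinj h =>
      hγ.ne_of_prong hinj (by omega) hζp hζ h⟩
    have : ∀ x ∈ ζ.source ∩ F.sing, x = q := by
      rintro x ⟨hx, hx'⟩
      by_contra hxq
      exact notMem_sing_of_prong (by omega) hpζ hζp hζ hx hxq hx'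
    intro x hx y hy
    rw [this x hx, this y hy]
  · obtain ⟨φ, hφ, hqφ⟩ := F.exists_chart q hq
    refine ⟨φ.source, φ.open_source.mem_nhds hqφ, ?_, fun γ hγ hinj h =>
      hγ.ne_of_chart hinj hφ h⟩
    rintro x ⟨hx, hx'⟩
    exact (F.source_subset φ hφ hx hx').elim

end SingularMeasuredFoliation

end

/-! ### Straight segments and their lengths -/

section

variable {X : Type*} [TopologicalSpace X]

namespace SingularMeasuredFoliation

/-- A common chart of two foliations: `F` is horizontal and `G` is vertical. -/
def IsPairChart (F G : SingularMeasuredFoliation X) (φ : OpenPartialHomeomorph X (ℝ × ℝ)) : Prop :=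
  φ ∈ F.charts ∧ φ.transHomeomorph (Homeomorph.prodComm ℝ ℝ) ∈ G.charts

/-- The map `σ` runs on `(a, b)` through a leaf of `F` at constant speed `c` with respect to the
transverse measure of `G`. -/
structure IsStraight (F G : SingularMeasuredFoliation X) (c : ℝ) (σ : ℝ → X) (a b : ℝ) : Prop where
  continuousOn : ContinuousOn σ (Set.Ioo a b)
  notMem_sing : ∀ u ∈ Set.Ioo a b, σ u ∉ F.sing
  horizontal : ∀ u ∈ Set.Ioo a b, ∀ φ, IsPairChart F G φ → σ u ∈ φ.source →
    AffineAlong c (𝓝 u) (fun u' => (φ (σ u')).1) id ∧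
      ∀ᶠ u' in 𝓝 u, (φ (σ u')).2 = (φ (σ u)).2

variable {F G : SingularMeasuredFoliation X}

theorem IsPairChart.affineAlong_fst {φ ψ : OpenPartialHomeomorph X (ℝ × ℝ)}
    (hφ : IsPairChart F G φ) (hψ : IsPairChart F G ψ) {x : X} (hx : x ∈ φ.source)
    (hx' : x ∈ ψ.source) : AffineAlong 1 (𝓝 x) (fun x' => (φ x').1) (fun x' => (ψ x').1) :=
  affineAlong_charts hφ.2 hψ.2 hx hx'

/-- One common chart at each time suffices: two common charts differ in each coordinate by a sign
and a translation. -/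
theorem isStraight_of_local {c a b : ℝ} {σ : ℝ → X} (hσ : ContinuousOn σ (Set.Ioo a b))
    (h : ∀ u ∈ Set.Ioo a b, ∃ φ, IsPairChart F G φ ∧ σ u ∈ φ.source ∧
      AffineAlong c (𝓝 u) (fun u' => (φ (σ u')).1) id ∧
      ∀ᶠ u' in 𝓝 u, (φ (σ u')).2 = (φ (σ u)).2) : IsStraight F G c σ a b where
  continuousOn := hσ
  notMem_sing := fun u hu => by
    obtain ⟨φ, hφ, huφ, -⟩ := h u hu
    exact F.source_subset φ hφ.1 huφ
  horizontal := fun u hu ψ hψ huψ => by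
    obtain ⟨φ, hφ, huφ, h1, h2⟩ := h u hu
    have hc : ContinuousAt σ u := hσ.continuousAt (Ioo_mem_nhds hu.1 hu.2)
    refine ⟨by simpa using ((hψ.affineAlong_fst hφ huψ huφ).comp hc).trans h1, ?_⟩
    obtain ⟨ε, e, -, h3⟩ := (affineAlong_charts hψ.1 hφ.1 huψ huφ).comp hc
    have h6 := h3.self_of_nhds
    filter_upwards [h2, h3] with u' h4 h5
    exact h5.trans (h4 ▸ h6.symm)

/-- The factor `d` for `F` only matters through leaves going to leaves; the speed is measured by `G`
and is divided by its factor `c'`. -/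
theorem IsStraight.image {c d c' a b : ℝ} {σ : ℝ → X} (h : IsStraight F G c σ a b) {g : X → X}
    (hg : Continuous g) (hF : F.HasImage g d F) (hd : d ≠ 0) (hG : G.HasImage g c' G)
    (hc' : c' ≠ 0) (hFG : F.Transverse G) : IsStraight F G (c'⁻¹ * c) (g ∘ σ) a b := by
  refine isStraight_of_local (hg.comp_continuousOn h.continuousOn) fun u hu => ?_
  have hreg := h.notMem_sing u hu
  have hreg' : g (σ u) ∉ F.sing := by rwa [hF.mem_sing_iff]
  obtain ⟨φ, hφ, huφ, hφ'⟩ := hFG.regular _ hreg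
  obtain ⟨ψ, hψ, huψ, hψ'⟩ := hFG.regular _ hreg'
  obtain ⟨h1, h2⟩ := h.horizontal u hu φ ⟨hφ, hφ'⟩ huφ
  have hc : ContinuousAt σ u := h.continuousOn.continuousAt (Ioo_mem_nhds hu.1 hu.2)
  refine ⟨ψ, ⟨hψ, hψ'⟩, huψ, ?_, ?_⟩
  · exact (((hG.affineAlong hφ' hψ' huφ huψ).symm hc').comp hc).trans h1
  · obtain ⟨ε, e, -, h3⟩ := ((hF.affineAlong hφ hψ huφ huψ).symm hd).comp hc
    have h6 := h3.self_of_nhds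
    filter_upwards [h2, h3] with u' h4 h5
    exact h5.trans (h4 ▸ h6.symm)

/-! ### Gauges, and the smallness of short segments. -/

/-- A gauge at `q`: a function on a neighbourhood of `q` that is in suitable common charts of the two
foliations the squared distance from some point, and whose sublevel sets shrink to `q`. -/
structure IsGauge (F G : SingularMeasuredFoliation X) (q : X) (O : Set X) (M : X → ℝ) : Prop where
  isOpen : IsOpen O
  mem : q ∈ O
  continuousAt : ContinuousAt M q
  apply_self : M q = 0
  basis : ∀ V ∈ 𝓝 q, ∃ ρ > 0, IsClosed {x ∈ O | M x ≤ ρ} ∧ {x ∈ O | M x ≤ ρ} ⊆ V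
  chart : ∀ x ∈ O, x ∉ F.sing → ∃ φ, IsPairChart F G φ ∧ x ∈ φ.source ∧ ∃ a b : ℝ,
    ∀ᶠ x' in 𝓝 x, M x' = ((φ x').1 - a) ^ 2 + ((φ x').2 - b) ^ 2

/-- The source of `e` is only open, but a small sublevel set is the image of a compact set under
`e.symm`, hence closed in the Hausdorff space `X`. -/
theorem _root_.OpenPartialHomeomorph.isClosed_sublevel [T2Space X] {E : Type*} [NormedAddCommGroup E]
    [ProperSpace E] (e : OpenPartialHomeomorph X E) {q : X} (hq : q ∈ e.source) {m : E → ℝ}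
    (hm : Continuous m) (h : ∀ r > 0, ∃ ρ > 0, ∀ v, m v ≤ ρ → v ∈ Metric.closedBall (e q) r)
    {V : Set X} (hV : V ∈ 𝓝 q) :
    ∃ ρ > 0, IsClosed {x ∈ e.source | m (e x) ≤ ρ} ∧ {x ∈ e.source | m (e x) ≤ ρ} ⊆ V := by
  have hV' : e.target ∩ e.symm ⁻¹' V ∈ 𝓝 (e q) := by
    refine Filter.inter_mem (e.open_target.mem_nhds (e.map_source hq)) ?_
    exact e.tendsto_symm hq hV
  obtain ⟨r, hr, hrV⟩ := Metric.nhds_basis_closedBall.mem_iff.1 hV'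
  obtain ⟨ρ, hρ, hρr⟩ := h r hr
  refine ⟨ρ, hρ, ?_, ?_⟩
  · have : {x ∈ e.source | m (e x) ≤ ρ} = e.symm '' {v | m v ≤ ρ} := by
      ext x
      constructor
      · rintro ⟨hx, hx'⟩
        exact ⟨e x, hx', e.left_inv hx⟩
      · rintro ⟨v, hv, rfl⟩
        have hvt := (hrV (hρr v hv)).1
        refine ⟨e.map_target hvt, ?_⟩
        rw [e.right_inv hvt]
        exact hv
    rw [this]
    refine IsCompact.isClosed (IsCompact.image_of_continuousOn ?_ ?_)
    · exact (isCompact_closedBall (e q) r).of_isClosed_subset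
        (isClosed_le hm continuous_const) hρr
    · exact e.continuousOn_symm.mono fun v hv => (hrV (hρr v hv)).1
  · rintro x ⟨hx, hx'⟩
    have := (hrV (hρr _ hx')).2
    rwa [Set.mem_preimage, e.left_inv hx] at this

/-- At a regular point the gauge is the squared distance in a common chart. At a `k`-prong it is
`‖ζ‖ ^ k`, the squared modulus of every branch of `ζ ^ (k / 2)`. -/
theorem Transverse.exists_isGauge [T2Space X] (h : F.Transverse G) (q : X) :
    ∃ O M, IsGauge F G q O M := by
  by_cases hq : q ∈ F.sing
  · obtain ⟨k, hk, ζ, hpζ, hζp, hζ⟩ := h.singular q hq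
    have hk0 : k ≠ 0 := by omega
    refine ⟨ζ.source, fun x => ‖ζ x‖ ^ k, ζ.open_source, hpζ,
      ((ζ.continuousAt hpζ).norm.pow k), by simp [hζp, hk0], fun V hV => ?_, fun x hx hxs => ?_⟩
    · refine ζ.isClosed_sublevel hpζ (m := fun z => ‖z‖ ^ k) (by fun_prop) (fun r hr => ?_) hV
      refine ⟨r ^ k, by positivity, fun v hv => ?_⟩
      rw [hζp, mem_closedBall_zero_iff]
      exact le_of_pow_le_pow_left₀ hk0 hr.le hv
    · have hx0 : ζ x ≠ 0 := by
        apply chart_apply_ne_zero hpζ hζp hx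
        rintro rfl
        exact hxs hq
      obtain ⟨φ, hφ, hxφ⟩ := exists_isProngBranch hk0 hζp hx hx0
      refine ⟨φ, hζ φ hφ, hxφ, 0, 0, ?_⟩
      filter_upwards [φ.open_source.mem_nhds hxφ] with x' hx'
      rw [← norm_pow, ← hφ.2 x' hx', norm_pow, Complex.sq_norm, Complex.normSq_apply]
      simp [pow_two]
  · obtain ⟨φ, hφ, hqφ, hφ'⟩ := h.regular q hq
    refine ⟨φ.source, fun x => ((φ x).1 - (φ q).1) ^ 2 + ((φ x).2 - (φ q).2) ^ 2, φ.open_source, hqφ,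
      ?_, by simp, fun V hV => ?_, fun x hx _ => ⟨φ, ⟨hφ, hφ'⟩, hx, _, _,
        Filter.Eventually.of_forall fun _ => rfl⟩⟩
    · have := φ.continuousAt hqφ
      exact ((this.fst.sub continuousAt_const).pow 2).add ((this.snd.sub continuousAt_const).pow 2)
    · refine φ.isClosed_sublevel hqφ
        (m := fun v => (v.1 - (φ q).1) ^ 2 + (v.2 - (φ q).2) ^ 2) (by fun_prop) (fun r hr => ?_) hV
      refine ⟨r ^ 2, by positivity, fun v hv => ?_⟩
      rw [Metric.mem_closedBall, Prod.dist_eq, max_le_iff, Real.dist_eq, Real.dist_eq]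
      constructor
      · apply abs_le_of_sq_le_sq _ hr.le
        nlinarith [sq_nonneg (v.2 - (φ q).2)]
      · apply abs_le_of_sq_le_sq _ hr.le
        nlinarith [sq_nonneg (v.1 - (φ q).1)]

/-- Along a straight segment of speed `c` a regularised gauge is `c`-Lipschitz. -/
theorem IsStraight.hasDerivAt_gauge {c a b : ℝ} {σ : ℝ → X} (h : IsStraight F G c σ a b)
    (hc : 0 ≤ c) {q : X} {O : Set X} {M : X → ℝ} (hM : IsGauge F G q O M) {η : ℝ} (hη : 0 < η)
    {u : ℝ} (hu : u ∈ Set.Ioo a b) (huO : σ u ∈ O) :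
    0 ≤ M (σ u) ∧ ∃ s, HasDerivAt (fun u' => √(η ^ 2 + M (σ u'))) s u ∧ ‖s‖ ≤ c := by
  obtain ⟨φ, hφ, huφ, a', b', hMφ⟩ := hM.chart _ huO (h.notMem_sing u hu)
  obtain ⟨⟨ε, e, hε, h1⟩, h2⟩ := h.horizontal u hu φ hφ huφ
  have hcont : ContinuousAt σ u := h.continuousOn.continuousAt (Ioo_mem_nhds hu.1 hu.2)
  have h3 := hcont.eventually hMφ
  set f := (φ (σ u)).2 - b'
  -- In a common chart the segment is horizontal of speed `c`, so `M` is a quadratic polynomial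
  -- along it. The term `η ^ 2` keeps the square root differentiable where `M` vanishes.
  have h4 : ∀ᶠ u' in 𝓝 u, M (σ u') = (ε * (c * u') + (e - a')) ^ 2 + f ^ 2 := by
    filter_upwards [h1, h2, h3] with u' g1 g2 g3
    rw [g3, g1, g2]
    simp only [id]
    ring
  refine ⟨by rw [h4.self_of_nhds]; positivity, ?_⟩
  set p := ε * (c * u) + (e - a')
  have hpos : 0 < η ^ 2 + (p ^ 2 + f ^ 2) := by positivity
  have hd : HasDerivAt (fun u' => √(η ^ 2 + ((ε * (c * u') + (e - a')) ^ 2 + f ^ 2)))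
      (((2 : ℕ) * p ^ 1 * (ε * (c * 1))) / (2 * √(η ^ 2 + (p ^ 2 + f ^ 2)))) u := by
    refine HasDerivAt.sqrt ?_ hpos.ne'
    refine HasDerivAt.const_add _ (HasDerivAt.add_const _ ?_)
    exact ((((hasDerivAt_id u).const_mul c).const_mul ε).add_const _).pow 2
  refine ⟨_, hd.congr_of_eventuallyEq (h4.mono fun u' h5 => by simp only [h5]), ?_⟩
  have hsq : |p| ≤ √(η ^ 2 + (p ^ 2 + f ^ 2)) := by
    apply Real.abs_le_sqrt
    nlinarith [sq_nonneg η, sq_nonneg f]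
  have hε' : |ε| = 1 := by rcases hε with rfl | rfl <;> simp
  have hs := Real.sqrt_pos.2 hpos
  rw [Real.norm_eq_abs, abs_div, abs_mul, abs_mul, abs_mul, abs_mul, hε', abs_of_pos (a := 2 * _)
    (by positivity), div_le_iff₀ (by positivity)]
  simp only [pow_one, mul_one, one_mul, abs_one, abs_of_nonneg hc, Nat.cast_ofNat, abs_two]
  nlinarith

/-- A short straight segment that starts close to `q` stays close to `q`. -/
theorem Transverse.exists_stay [T2Space X] (hFG : F.Transverse G) (q : X) {V : Set X} (hV : V ∈ 𝓝 q) :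
    ∃ U ∈ 𝓝 q, ∃ r > 0, ∀ (σ : ℝ → X) (a b c : ℝ), 0 ≤ c → IsStraight F G c σ a b →
      c * (b - a) ≤ r → ∀ u₀ ∈ Set.Ioo a b, σ u₀ ∈ U → ∀ u ∈ Set.Ioo a b, σ u ∈ V := by
  obtain ⟨O, M, hM⟩ := hFG.exists_isGauge q
  obtain ⟨ρ, hρ, hcl, hsub⟩ := hM.basis V hV
  -- The regularised gauge starts below `2 η` and grows by at most `η`, so it stays below `3 η =
  -- √ρ`, which forces `M ≤ ρ`.
  set η := √ρ / 3
  have hη : 0 < η := by positivity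
  have hηρ : 9 * η ^ 2 = ρ := by
    rw [div_pow, Real.sq_sqrt hρ.le]; ring
  refine ⟨O ∩ {x | M x < η ^ 2}, Filter.inter_mem (hM.isOpen.mem_nhds hM.mem) ?_, η, hη, ?_⟩
  · exact hM.continuousAt.eventually_lt continuousAt_const (by rw [hM.apply_self]; positivity)
  intro σ a b c hc hσ hr u₀ hu₀ hσu₀
  set C := {x ∈ O | M x ≤ ρ}
  set W := Set.Ioo a b ∩ σ ⁻¹' O
  have hW : IsOpen W := hσ.continuousOn.isOpen_inter_preimage isOpen_Ioo hM.isOpen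
  have hu₀W : u₀ ∈ W := ⟨hu₀, hσu₀.1⟩
  set K := connectedComponentIn W u₀
  have hKW : K ⊆ W := connectedComponentIn_subset W u₀
  have hKconv : Convex ℝ K := Real.convex_iff_isPreconnected.2 isPreconnected_connectedComponentIn
  have hKC : ∀ u ∈ K, σ u ∈ C := by
    intro u hu
    have huW := hKW hu
    refine ⟨huW.2, ?_⟩
    have hder : ∀ v ∈ K, ∃ s, HasDerivAt (fun u' => √(η ^ 2 + M (σ u'))) s v ∧ ‖s‖ ≤ c :=
      fun v hv => (hσ.hasDerivAt_gauge hc hM hη (hKW hv).1 (hKW hv).2).2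
    choose! s hs hs' using hder
    have hlip := hKconv.norm_image_sub_le_of_norm_hasDerivWithin_le
      (fun v hv => (hs v hv).hasDerivWithinAt) hs' (mem_connectedComponentIn hu₀W) hu
    have hdist : ‖u - u₀‖ ≤ b - a := by
      rw [Real.norm_eq_abs, abs_le]
      constructor <;> linarith [huW.1.1, huW.1.2, hu₀.1, hu₀.2]
    have h1 : √(η ^ 2 + M (σ u)) - √(η ^ 2 + M (σ u₀)) ≤ η :=
      (le_abs_self _).trans (hlip.trans ((mul_le_mul_of_nonneg_left hdist hc).trans hr))
    have h2 : √(η ^ 2 + M (σ u₀)) ≤ 2 * η := by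
      rw [Real.sqrt_le_left (by positivity)]
      have : M (σ u₀) < η ^ 2 := hσu₀.2
      nlinarith
    have h3 : √(η ^ 2 + M (σ u)) ≤ 3 * η := by linarith
    rw [Real.sqrt_le_left (by positivity)] at h3
    nlinarith
  -- The segment cannot leave `O`: at a limit time of `K` the closedness of `C` keeps the point in
  -- `C ⊆ O`, so that time belongs to `K` again.
  have hall : Set.Ioo a b ⊆ K := by
    refine isPreconnected_Ioo.subset_of_closure_inter_subset hW.connectedComponentIn
      ⟨u₀, hu₀, mem_connectedComponentIn hu₀W⟩ ?_
    rintro x ⟨hxK, hx⟩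
    have hxC : σ x ∈ C := by
      have hcx : ContinuousAt σ x := hσ.continuousOn.continuousAt (Ioo_mem_nhds hx.1 hx.2)
      exact hcl.mem_of_frequently_of_tendsto
        ((mem_closure_iff_frequently.1 hxK).mono hKC) hcx
    have hxW : x ∈ W := ⟨hx, hxC.1⟩
    have hpre : IsPreconnected (insert x K) :=
      isPreconnected_connectedComponentIn.subset_closure (Set.subset_insert _ _)
        (Set.insert_subset hxK subset_closure)
    exact hpre.subset_connectedComponentIn (Set.mem_insert_of_mem _ (mem_connectedComponentIn hu₀W))
      (Set.insert_subset hxW hKW) (Set.mem_insert _ _)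
  exact fun u hu => hsub (hKC u (hall hu))

end SingularMeasuredFoliation

end

/-! ### Contraction of leaf paths and arationality -/

section

variable {X : Type*} [TopologicalSpace X]

/-- The maps `g n` contract the set `A` uniformly as `n` tends to infinity: if `g n` takes some
point of `A` close to `q`, then it takes all of `A` close to `q`. -/
def IsContracted (g : ℕ → X → X) (A : Set X) : Prop :=
  ∀ q, ∀ V ∈ 𝓝 q, ∃ U ∈ 𝓝 q, ∃ N, ∀ n ≥ N, (∃ a ∈ A, g n a ∈ U) → ∀ a ∈ A, g n a ∈ V

namespace IsContracted

variable {g : ℕ → X → X} {A B : Set X}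

theorem singleton (x : X) : IsContracted g {x} := by
  refine fun q V hV => ⟨V, hV, 0, fun n _ => ?_⟩
  rintro ⟨_, rfl, h⟩ _ rfl
  exact h

theorem mono (h : IsContracted g B) (hAB : A ⊆ B) : IsContracted g A := by
  intro q V hV
  obtain ⟨U, hU, N, hN⟩ := h q V hV
  exact ⟨U, hU, N, fun n hn ⟨a, ha, hau⟩ a' ha' => hN n hn ⟨a, hAB ha, hau⟩ a' (hAB ha')⟩

/-- The common point `p` transmits closeness to `q` from one set to the other, so neighbourhoods are
chosen twice: first those that control `A` and `B` from `p`, then those that force `p` into them. -/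
theorem union (hA : IsContracted g A) (hB : IsContracted g B) {p : X} (hpA : p ∈ A) (hpB : p ∈ B) :
    IsContracted g (A ∪ B) := by
  intro q V hV
  obtain ⟨UA, hUA, NA, hNA⟩ := hA q V hV
  obtain ⟨UB, hUB, NB, hNB⟩ := hB q V hV
  obtain ⟨UA', hUA', NA', hNA'⟩ := hA q (V ∩ (UA ∩ UB)) (Filter.inter_mem hV (Filter.inter_mem hUA hUB))
  obtain ⟨UB', hUB', NB', hNB'⟩ := hB q (V ∩ (UA ∩ UB)) (Filter.inter_mem hV (Filter.inter_mem hUA hUB))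
  refine ⟨UA' ∩ UB', Filter.inter_mem hUA' hUB', max (max NA NB) (max NA' NB'), fun n hn => ?_⟩
  simp only [ge_iff_le, max_le_iff] at hn
  have key : (∃ a ∈ A ∪ B, g n a ∈ UA' ∩ UB') → g n p ∈ UA ∩ UB := by
    rintro ⟨a, ha | ha, hau⟩
    · exact (hNA' n hn.2.1 ⟨a, ha, hau.1⟩ p hpA).2
    · exact (hNB' n hn.2.2 ⟨a, ha, hau.2⟩ p hpB).2
  rintro h a (ha | ha)
  · exact hNA n hn.1.1 ⟨p, hpA, (key h).1⟩ a ha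
  · exact hNB n hn.1.2 ⟨p, hpB, (key h).2⟩ a ha

end IsContracted

namespace SingularMeasuredFoliation

variable {F G : SingularMeasuredFoliation X}

/-- The maps `g n` take straight segments to straight segments of speeds tending to zero. -/
structure ContractsLeaves (F G : SingularMeasuredFoliation X) (g : ℕ → X → X) (c : ℕ → ℝ) : Prop where
  continuous : ∀ n, Continuous (g n)
  nonneg : ∀ n, 0 ≤ c n
  tendsto : Filter.Tendsto c Filter.atTop (𝓝 0)
  isStraight : ∀ n σ a b, IsStraight F G 1 σ a b → IsStraight F G (c n) (g n ∘ σ) a b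

/-- A union of straight segments of bounded length that issue from a common point is contracted. -/
theorem ContractsLeaves.isContracted_of_segments [T3Space X] {g : ℕ → X → X} {c : ℕ → ℝ}
    (hg : ContractsLeaves F G g c) (hFG : F.Transverse G) {A : Set X} {p : X} {l : ℝ}
    (hA : ∀ x ∈ A, ∃ σ a b, IsStraight F G 1 σ a b ∧ b - a ≤ l ∧
      x ∈ closure (σ '' Set.Ioo a b) ∧ p ∈ closure (σ '' Set.Ioo a b)) : IsContracted g A := by
  intro q V hV
  -- Closeness to `q` passes from `x` to `p` and from `p` to `y`. Closed neighbourhoods are used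
  -- since these points may be endpoints, for instance singularities, that lie only in the closures
  -- of the segments.
  obtain ⟨V₁, hV₁, hV₁c, hV₁V⟩ := exists_mem_nhds_isClosed_subset hV
  obtain ⟨U₁, hU₁, r₁, hr₁, hstay₁⟩ := hFG.exists_stay q hV₁
  obtain ⟨V₂, hV₂, hV₂c, hV₂U⟩ := exists_mem_nhds_isClosed_subset (interior_mem_nhds.2 hU₁)
  obtain ⟨U₂, hU₂, r₂, hr₂, hstay₂⟩ := hFG.exists_stay q hV₂
  have hlim : Filter.Tendsto (fun n => c n * l) Filter.atTop (𝓝 0) := by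
    simpa using hg.tendsto.mul_const l
  obtain ⟨N, hN⟩ := Filter.eventually_atTop.1 (hlim.eventually_lt_const (lt_min hr₁ hr₂))
  refine ⟨interior U₂, interior_mem_nhds.2 hU₂, N, fun n hn => ?_⟩
  have hspeed : ∀ {a b : ℝ}, b - a ≤ l → c n * (b - a) ≤ min r₁ r₂ := fun h =>
    (mul_le_mul_of_nonneg_left h (hg.nonneg n)).trans (hN n hn).le
  have hmeet : ∀ {σ : ℝ → X} {a b : ℝ} {x : X} {O : Set X}, x ∈ closure (σ '' Set.Ioo a b) →
      IsOpen O → g n x ∈ O → ∃ u ∈ Set.Ioo a b, g n (σ u) ∈ O := by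
    intro σ a b x O hx hO hxO
    obtain ⟨_, hy, u, hu, rfl⟩ :=
      mem_closure_iff.1 hx (g n ⁻¹' O) (hO.preimage (hg.continuous n)) hxO
    exact ⟨u, hu, hy⟩
  have hclos : ∀ {σ : ℝ → X} {a b : ℝ} {x : X} {C : Set X}, x ∈ closure (σ '' Set.Ioo a b) →
      IsClosed C → (∀ u ∈ Set.Ioo a b, g n (σ u) ∈ C) → g n x ∈ C := by
    intro σ a b x C hx hC h
    refine closure_minimal ?_ (hC.preimage (hg.continuous n)) hx
    rintro _ ⟨u, hu, rfl⟩
    exact h u hu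
  rintro ⟨x, hx, hxU⟩ y hy
  obtain ⟨σ, a, b, hσ, hab, hxσ, hpσ⟩ := hA x hx
  obtain ⟨u, hu, huU⟩ := hmeet hxσ isOpen_interior hxU
  have h1 := hstay₂ _ a b (c n) (hg.nonneg n) (hg.isStraight n σ a b hσ)
    ((hspeed hab).trans (min_le_right _ _)) u hu (interior_subset huU)
  have hp := hclos hpσ hV₂c h1
  obtain ⟨σ', a', b', hσ', hab', hyσ', hpσ'⟩ := hA y hy
  obtain ⟨u', hu', hu'U⟩ := hmeet hpσ' isOpen_interior (hV₂U hp)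
  have h2 := hstay₁ _ a' b' (c n) (hg.nonneg n) (hg.isStraight n σ' a' b' hσ')
    ((hspeed hab').trans (min_le_left _ _)) u' hu' (interior_subset hu'U)
  exact hV₁V (hclos hyσ' hV₁c h2)

theorem isStraight_chart {φ : OpenPartialHomeomorph X (ℝ × ℝ)} (hφ : IsPairChart F G φ)
    {y a b : ℝ} (h : ∀ u ∈ Set.Ioo a b, (u, y) ∈ φ.target) :
    IsStraight F G 1 (fun u => φ.symm (u, y)) a b := by
  refine isStraight_of_local (φ.continuousOn_symm.comp (by fun_prop) h) fun u hu => ?_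
  have hev : ∀ᶠ u' in 𝓝 u, φ (φ.symm (u', y)) = (u', y) := by
    filter_upwards [Ioo_mem_nhds hu.1 hu.2] with u' hu'
    exact φ.right_inv (h u' hu')
  refine ⟨φ, hφ, φ.map_target (h u hu), ⟨1, 0, Or.inl rfl, ?_⟩, ?_⟩
  · filter_upwards [hev] with u' hu'
    simp [hu']
  · filter_upwards [hev] with u' hu'
    rw [hu', φ.right_inv (h u hu)]

/-- The leaves of `F` that end at the singularity are the rays `ζ ^ k ≥ 0`. With `ζ = ω u ^ (2 / k)`
the branches of `ζ ^ (k / 2)` take the values `± u`, whence unit speed. -/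
theorem isStraight_prong {ζ : OpenPartialHomeomorph X ℂ} {p : X} {k : ℕ} (hk : k ≠ 0)
    (hζp : ζ p = 0)
    (hζ : ∀ φ, IsProngBranch ζ p k φ → IsPairChart F G φ) {ω : ℂ} (hω : ω ^ k = 1) {b : ℝ}
    (h : ∀ u ∈ Set.Ioo 0 b, ω * ((u ^ (2 / k : ℝ) : ℝ) : ℂ) ∈ ζ.target) :
    IsStraight F G 1 (fun u => ζ.symm (ω * ((u ^ (2 / k : ℝ) : ℝ) : ℂ))) 0 b := by
  have hcont : Continuous fun u : ℝ => ω * ((u ^ (2 / k : ℝ) : ℝ) : ℂ) :=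
    continuous_const.mul (Complex.continuous_ofReal.comp (Real.continuous_rpow_const (by positivity)))
  have hσ : ContinuousOn (fun u : ℝ => ζ.symm (ω * ((u ^ (2 / k : ℝ) : ℝ) : ℂ))) (Set.Ioo 0 b) :=
    ζ.continuousOn_symm.comp hcont.continuousOn h
  refine isStraight_of_local hσ fun u hu => ?_
  have hσu := hσ.continuousAt (Ioo_mem_nhds hu.1 hu.2)
  have hω0 : ω ≠ 0 := by
    rintro rfl
    simp [hk] at hω
  have hζσ : ∀ u ∈ Set.Ioo 0 b,
      ζ (ζ.symm (ω * ((u ^ (2 / k : ℝ) : ℝ) : ℂ))) = ω * ((u ^ (2 / k : ℝ) : ℝ) : ℂ) :=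
    fun u hu => ζ.right_inv (h u hu)
  obtain ⟨φ, hφ, huφ⟩ := exists_isProngBranch (k := k) hk hζp (ζ.map_target (h u hu)) (by
    rw [hζσ u hu]
    exact mul_ne_zero hω0 (Complex.ofReal_ne_zero.2 (Real.rpow_pos_of_pos hu.1 _).ne'))
  set σ := fun u : ℝ => ζ.symm (ω * ((u ^ (2 / k : ℝ) : ℝ) : ℂ)) with hσdef
  have hval : ∀ u ∈ Set.Ioo 0 b, σ u ∈ φ.source → (φ (σ u)).2 = 0 ∧ (φ (σ u)).1 ^ 2 = u ^ 2 := by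
    intro u hu huφ
    have h1 := hφ.2 _ huφ
    rw [show ζ (σ u) = _ from hζσ u hu, mul_pow, hω, one_mul, ← Complex.ofReal_pow,
      ← Real.rpow_natCast, ← Real.rpow_mul hu.1.le, div_mul_cancel₀ _ (by exact_mod_cast hk)] at h1
    have hre := congrArg Complex.re h1
    have him := congrArg Complex.im h1
    simp only [pow_two, Complex.mul_re, Complex.mul_im, Complex.ofReal_re, Complex.ofReal_im,
      Real.rpow_ofNat] at hre him
    have hu0 := hu.1
    have hy : (φ (σ u)).2 = 0 := by
      rcases mul_eq_zero.1 (by linarith : (φ (σ u)).1 * (φ (σ u)).2 = 0) with h2 | h2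
      · rw [h2] at hre
        nlinarith [mul_pos hu0 hu0, mul_self_nonneg (φ (σ u)).2]
      · exact h2
    refine ⟨hy, ?_⟩
    rw [hy] at hre
    nlinarith
  have hφσ : ContinuousAt (fun u' => φ (σ u')) u :=
    ContinuousAt.comp (g := φ) (f := σ) (φ.continuousAt huφ) hσu
  have hev : ∀ᶠ u' in 𝓝 u, u' ∈ Set.Ioo 0 b ∧ (φ (σ u')).2 = 0 ∧ (φ (σ u')).1 ^ 2 = u' ^ 2 := by
    filter_upwards [Ioo_mem_nhds hu.1 hu.2, hσu (φ.open_source.mem_nhds huφ)] with u' h1 h2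
    exact ⟨h1, hval u' h1 h2⟩
  refine ⟨φ, hζ φ hφ, huφ, ?_, ?_⟩
  · have hne : (φ (σ u)).1 ≠ 0 := by
      intro h0
      have := (hval u hu huφ).2
      rw [h0] at this
      have hu0 := hu.1
      nlinarith [mul_pos hu0 hu0]
    rcases lt_or_gt_of_ne hne with hneg | hpos
    · refine ⟨-1, 0, Or.inr rfl, ?_⟩
      filter_upwards [hev, hφσ.fst.eventually_lt continuousAt_const hneg] with u' h1 h2
      rcases sq_eq_sq_iff_eq_or_eq_neg.1 h1.2.2 with h3 | h3
      · linarith [h1.1.1]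
      · rw [h3]; simp
    · refine ⟨1, 0, Or.inl rfl, ?_⟩
      filter_upwards [hev, continuousAt_const.eventually_lt hφσ.fst hpos] with u' h1 h2
      rcases sq_eq_sq_iff_eq_or_eq_neg.1 h1.2.2 with h3 | h3
      · rw [h3]; simp
      · linarith [h1.1.1]
  · filter_upwards [hev] with u' h1
    rw [h1.2.1, (hval u hu huφ).1]

/-- Locally a leaf path lies in a star of segments around `γ t`: the plaque at a regular point, the
union of the `k` prongs at a singularity. -/
theorem ContractsLeaves.exists_nhds_isContracted [T3Space X] {g : ℕ → X → X} {c : ℕ → ℝ}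
    (hg : ContractsLeaves F G g c) (hFG : F.Transverse G) {γ : C(unitInterval, X)}
    (hγ : F.IsLeafPath γ) (t : unitInterval) : ∃ N ∈ 𝓝 t, IsContracted g (γ '' N) := by
  by_cases ht : γ t ∈ F.sing
  · obtain ⟨k, hk, ζ, hpζ, hζp, hζ⟩ := hFG.singular _ ht
    have hk0 : k ≠ 0 := by omega
    have hkR : (0 : ℝ) < k := by exact_mod_cast Nat.pos_of_ne_zero hk0
    set p := γ t
    have h0t : (0 : ℂ) ∈ ζ.target := hζp ▸ ζ.map_source hpζ
    obtain ⟨r, hr, hrζ⟩ := Metric.isOpen_iff.1 ζ.open_target 0 h0t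
    have hW : γ ⁻¹' (ζ.source ∩ {x | ‖ζ x‖ < r}) ∈ 𝓝 t := by
      refine γ.continuous.continuousAt (Filter.inter_mem (ζ.open_source.mem_nhds hpζ) ?_)
      exact (ζ.continuousAt hpζ).norm.eventually_lt continuousAt_const (by rw [hζp]; simpa using hr)
    obtain ⟨δ, hδ, hδW⟩ := Metric.mem_nhds_iff.1 hW
    set N := Metric.ball t δ
    have hNpre : IsPreconnected N := by
      have : N.OrdConnected := by
        refine ⟨fun x hx y hy z hz => ?_⟩
        rw [Metric.mem_ball, Subtype.dist_eq, Real.dist_eq, abs_lt] at hx hy ⊢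
        have h1 : (x : ℝ) ≤ z := hz.1
        have h2 : (z : ℝ) ≤ y := hz.2
        constructor <;> linarith
      exact this.isPreconnected
    have htN : t ∈ N := Metric.mem_ball_self hδ
    -- The single-valued `2 y ^ 2` is constant along the path and vanishes at `t`, so near `t` the
    -- path stays on the prongs.
    have hQ : ∀ u ∈ N, ‖ζ (γ u) ^ k‖ - (ζ (γ u) ^ k).re = 0 := by
      have := isPreconnected_iff_preconnectedSpace.1 hNpre
      have hc : Continuous fun u : N => ζ (γ u) :=
        ζ.continuousOn.comp_continuous (γ.continuous.comp continuous_subtype_val)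
          fun u => (hδW u.2).1
      intro u hu
      have h1 := eq_of_eventually_eq_of_ne_zero
        (Q := fun u : N => ‖ζ (γ u) ^ k‖ - (ζ (γ u) ^ k).re)
        ((hc.pow k).norm.sub (Complex.continuous_re.comp (hc.pow k))) (fun v hv => ?_)
        ⟨u, hu⟩ ⟨t, htN⟩
      · simpa [p, hζp, hk0] using h1
      · have hv0 : ζ (γ v) ≠ 0 := by
          intro h0
          simp [h0, hk0] at hv
        obtain ⟨φ, hφ, hvφ⟩ := exists_isProngBranch (k := k) hk0 hζp (hδW v.2).1 hv0
        filter_upwards [continuous_subtype_val.continuousAt.eventually (hγ v φ (hζ φ hφ).1 hvφ),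
          (γ.continuous.comp continuous_subtype_val).continuousAt
            (φ.open_source.mem_nhds hvφ)] with s hs hs'
        change γ s ∈ φ.source at hs'
        rw [norm_sub_re_of_isProngBranch hφ hs', norm_sub_re_of_isProngBranch hφ hvφ, hs]
    refine ⟨N, Metric.ball_mem_nhds t hδ, ?_⟩
    -- The length of a prong up to `‖ζ‖ = r`.
    set b : ℝ := r ^ (k / 2 : ℝ)
    have hb : 0 < b := Real.rpow_pos_of_pos hr _
    have hpw : ∀ u ∈ Set.Ioo 0 b, u ^ (2 / k : ℝ) < r := by
      intro u hu
      have : u ^ (2 / k : ℝ) < b ^ (2 / k : ℝ) := Real.rpow_lt_rpow hu.1.le hu.2 (by positivity)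
      rwa [← Real.rpow_mul hr.le, div_mul_div_cancel₀ (by norm_num), div_self hkR.ne',
        Real.rpow_one] at this
    have hseg : ∀ ω : ℂ, ω ^ k = 1 →
        IsStraight F G 1 (fun u => ζ.symm (ω * ((u ^ (2 / k : ℝ) : ℝ) : ℂ))) 0 b ∧
        p ∈ closure ((fun u : ℝ => ζ.symm (ω * ((u ^ (2 / k : ℝ) : ℝ) : ℂ))) '' Set.Ioo 0 b) := by
      intro ω hω
      have hω1 : ‖ω‖ = 1 := Complex.norm_eq_one_of_pow_eq_one hω hk0
      refine ⟨isStraight_prong hk0 hζp hζ hω fun u hu => hrζ ?_, ?_⟩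
      · rw [mem_ball_zero_iff, norm_mul, hω1, one_mul, Complex.norm_real, Real.norm_eq_abs,
          abs_of_nonneg (Real.rpow_nonneg hu.1.le _)]
        exact hpw u hu
      · have hval : ω * (((0 : ℝ) ^ (2 / k : ℝ) : ℝ) : ℂ) = 0 := by
          rw [Real.zero_rpow (by positivity)]; simp
        have hcont : Continuous fun u : ℝ => ω * ((u ^ (2 / k : ℝ) : ℝ) : ℂ) :=
          continuous_const.mul
            (Complex.continuous_ofReal.comp (Real.continuous_rpow_const (by positivity)))
        have h1 : ContinuousAt (fun u : ℝ => ζ.symm (ω * ((u ^ (2 / k : ℝ) : ℝ) : ℂ))) 0 :=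
          ContinuousAt.comp (f := fun u : ℝ => ω * ((u ^ (2 / k : ℝ) : ℝ) : ℂ)) (g := ζ.symm)
            (ζ.continuousAt_symm (by rw [hval]; exact h0t)) hcont.continuousAt
        have h2 := h1.continuousWithinAt.mem_closure_image (s := Set.Ioo 0 b)
          (by rw [closure_Ioo hb.ne]; exact ⟨le_rfl, hb.le⟩)
        convert h2 using 1
        rw [hval, ← hζp, ζ.left_inv hpζ]
    refine hg.isContracted_of_segments hFG (p := p) (l := b) ?_
    rintro _ ⟨u, hu, rfl⟩
    by_cases hZ : ζ (γ u) = 0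
    -- At the singularity itself any prong will do.
    · obtain ⟨h1, h2⟩ := hseg 1 (one_pow k)
      refine ⟨_, 0, b, h1, by simp, ?_, h2⟩
      rwa [ζ.injOn (hδW hu).1 hpζ (hZ.trans hζp.symm)]
    · set Z := ζ (γ u) with hZdef
      have hZn : 0 < ‖Z‖ := norm_pos_iff.2 hZ
      have hZk : Z ^ k = ((‖Z‖ ^ k : ℝ) : ℂ) := by
        have h1 := hQ u hu
        have h3 : ‖Z ^ k‖ = (Z ^ k).re := by linarith
        have h2 : (Z ^ k).im = 0 := by
          have := Complex.sq_norm (Z ^ k)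
          rw [Complex.normSq_apply, h3] at this
          nlinarith
        rw [← norm_pow]
        apply Complex.ext
        · rw [Complex.ofReal_re]; linarith
        · rw [Complex.ofReal_im, h2]
      have hω : (Z / ‖Z‖) ^ k = 1 := by
        rw [div_pow, hZk, Complex.ofReal_pow, div_self]
        exact pow_ne_zero _ (Complex.ofReal_ne_zero.2 hZn.ne')
      obtain ⟨h1, h2⟩ := hseg _ hω
      refine ⟨_, 0, b, h1, by simp, subset_closure ⟨‖Z‖ ^ (k / 2 : ℝ), ⟨?_, ?_⟩, ?_⟩, h2⟩
      · exact Real.rpow_pos_of_pos hZn _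
      · exact Real.rpow_lt_rpow hZn.le (hδW hu).2 (by positivity)
      · simp only
        rw [← Real.rpow_mul hZn.le, div_mul_div_cancel₀ (by norm_num), div_self hkR.ne',
          Real.rpow_one, div_mul_cancel₀ _ (Complex.ofReal_ne_zero.2 hZn.ne'), hZdef,
          ζ.left_inv (hδW hu).1]
  · obtain ⟨φ, hφ, htφ, hφ'⟩ := hFG.regular _ ht
    obtain ⟨r, hr, hrφ⟩ := Metric.isOpen_iff.1 φ.open_target _ (φ.map_source htφ)
    refine ⟨{u | γ u ∈ φ.source ∧ (φ (γ u)).2 = (φ (γ t)).2 ∧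
      (φ (γ u)).1 ∈ Set.Ioo ((φ (γ t)).1 - r) ((φ (γ t)).1 + r)}, ?_, ?_⟩
    · have h1 := γ.continuous.continuousAt (x := t) (φ.open_source.mem_nhds htφ)
      have h2 := hγ t φ hφ htφ
      have h3 : ContinuousAt (fun u => (φ (γ u)).1) t :=
        ((φ.continuousAt htφ).comp γ.continuous.continuousAt).fst
      have h4 := h3 (Ioo_mem_nhds (sub_lt_self (φ (γ t)).1 hr) (lt_add_of_pos_right (φ (γ t)).1 hr))
      filter_upwards [h1, h2, h4] with u g1 g2 g3
      exact ⟨g1, g2, g3⟩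
    · have hst := isStraight_chart (F := F) (G := G) ⟨hφ, hφ'⟩ (y := (φ (γ t)).2)
        (a := (φ (γ t)).1 - r) (b := (φ (γ t)).1 + r) (fun u hu => hrφ (by
          rw [Metric.mem_ball, Prod.dist_eq, max_lt_iff]
          refine ⟨?_, by simpa using hr⟩
          rw [Real.dist_eq, abs_lt]
          constructor <;> linarith [hu.1, hu.2]))
      refine hg.isContracted_of_segments hFG (p := γ t) (l := 2 * r) ?_
      rintro _ ⟨u, ⟨hu1, hu2, hu3⟩, rfl⟩
      refine ⟨_, _, _, hst, by linarith, subset_closure ⟨_, hu3, ?_⟩,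
        subset_closure ⟨(φ (γ t)).1, ⟨by linarith, by linarith⟩, ?_⟩⟩
      · simp only
        rw [← hu2, Prod.mk.eta, φ.left_inv hu1]
      · exact φ.left_inv htφ

theorem ContractsLeaves.isContracted_range [T3Space X] {g : ℕ → X → X} {c : ℕ → ℝ}
    (hg : ContractsLeaves F G g c) (hFG : F.Transverse G) {γ : C(unitInterval, X)}
    (hγ : F.IsLeafPath γ) : IsContracted g (Set.range γ) := by
  choose N hN hNc using hg.exists_nhds_isContracted hFG hγ
  obtain ⟨t, ht0, htm, ⟨n, hn⟩, htN⟩ := exists_monotone_Icc_subset_open_cover_unitInterval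
    (c := fun s => interior (N s)) (fun _ => isOpen_interior)
    (fun s _ => Set.mem_iUnion.2 ⟨s, mem_interior_iff_mem_nhds.2 (hN s)⟩)
  have key : ∀ m, IsContracted g (γ '' Set.Icc 0 (t m)) := by
    intro m
    induction m with
    | zero => simpa [ht0] using IsContracted.singleton (γ 0)
    | succ m ih =>
      obtain ⟨i, hi⟩ := htN m
      have h0 : 0 ≤ t m := ht0 ▸ htm (Nat.zero_le m)
      have h1 := (hNc i).mono (Set.image_mono (hi.trans interior_subset))
      rw [← Set.Icc_union_Icc_eq_Icc h0 (htm m.le_succ), Set.image_union]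
      exact ih.union h1 (p := γ (t m)) ⟨_, ⟨h0, le_rfl⟩, rfl⟩ ⟨_, ⟨le_rfl, htm m.le_succ⟩, rfl⟩
  refine (key n).mono ?_
  rintro _ ⟨s, rfl⟩
  exact ⟨s, ⟨unitInterval.nonneg', by rw [hn n le_rfl]; exact unitInterval.le_one'⟩, rfl⟩

/-- A foliation is arational if there are homeomorphisms preserving it that contract its leaves
and that do not take points to infinity. -/
theorem isArational_of_contracting [T3Space X] (hFG : F.Transverse G) {K : Set X} (hK : IsCompact K)
    {c : ℝ} (hc0 : 0 < c) (hc1 : c < 1)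
    (hg : ∀ (n : ℕ) (x : X), ∃ g : X ≃ₜ X, g x ∈ K ∧ F.HasImage g (c ^ n) F ∧
      G.HasImage g (c ^ n)⁻¹ G) : F.IsArational := by
  intro γ hγ hinj
  choose g hgK hgF hgG using fun n => hg n (γ 0)
  have hcn : ∀ n, c ^ n ≠ 0 := fun n => pow_ne_zero _ hc0.ne'
  have hcon : ContractsLeaves F G (fun n => g n) (fun n => c ^ n) :=
    { continuous := fun n => (g n).continuous
      nonneg := fun n => by positivity
      tendsto := tendsto_pow_atTop_nhds_zero_of_lt_one hc0.le hc1
      isStraight := fun n σ a b h => by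
        simpa using h.image (g n).continuous (hgF n) (hcn n) (hgG n) (inv_ne_zero (hcn n)) hFG }
  have hcontr := hcon.isContracted_range hFG hγ
  -- For suitable large `n` the point `g n (γ 0)` is close to a cluster point `q`, and contraction
  -- puts the whole path `g n ∘ γ` into `V`. It is again a path in a leaf of `F`, so it neither
  -- closes up nor meets two singularities.
  obtain ⟨q, -, hq⟩ := hK.exists_clusterPt (f := Filter.map (fun n => g n (γ 0)) Filter.atTop)
    (by simp [hgK])
  obtain ⟨V, hV, hVγ⟩ := F.exists_nhds_leafPath q
  obtain ⟨U, hU, N, hN⟩ := hcontr q V hV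
  have hfreq : ∃ᶠ n in Filter.atTop, g n (γ 0) ∈ U := (mapClusterPt_iff_frequently.1 hq) U hU
  obtain ⟨n, hn, hnU⟩ := Filter.frequently_atTop.1 hfreq N
  have hmem := hN n hn ⟨γ 0, ⟨0, rfl⟩, hnU⟩
  have hleaf : F.IsLeafPath ((ContinuousMap.mk (g n) (g n).continuous).comp γ) := by
    intro t φ hφ htφ
    have htφ' : g n (γ t) ∈ φ.source := htφ
    have hreg : γ t ∉ F.sing := by
      rw [← (hgF n).mem_sing_iff]; exact F.source_subset φ hφ htφ
    obtain ⟨ψ, hψ, htψ⟩ := F.exists_chart _ hreg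
    have h3 := hγ t ψ hψ htψ
    obtain ⟨ε, e, -, h4⟩ := (((hgF n).affineAlong hψ hφ htψ htφ').symm (hcn n)).comp
      (γ.continuous.continuousAt (x := t))
    have h6 := h4.self_of_nhds
    filter_upwards [h3, h4] with s g1 g2
    exact g2.trans (g1 ▸ h6.symm)
  obtain ⟨h1, h2⟩ := hVγ _ hleaf ((g n).injective.comp_injOn hinj) (fun t => hmem _ ⟨t, rfl⟩)
  refine ⟨fun h => h1 (by simp [h]), ?_⟩
  intro s hs t ht
  refine h2 ?_ ?_
  · exact ((hgF n).mem_sing_iff _).2 hs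
  · exact ((hgF n).mem_sing_iff _).2 ht

end SingularMeasuredFoliation

end

/-! ### Extension of local homomorphisms -/

/-- A map from a ball of a real normed space to a monoid that is additive wherever this makes sense
extends to a homomorphism. -/
theorem exists_extension_of_local_hom {V M : Type*} [NormedAddCommGroup V] [NormedSpace ℝ V] [Monoid M]
    {ε : ℝ} (hε : 0 < ε) (τ : V → M)
    (hτ : ∀ v w, ‖v‖ < ε → ‖w‖ < ε → ‖v + w‖ < ε → τ (v + w) = τ v * τ w) :
    ∃ T : V → M, (∀ v w, T (v + w) = T v * T w) ∧ ∀ v, ‖v‖ < ε → T v = τ v := by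
  have hpow : ∀ (u : V) (n : ℕ), ‖((n + 1 : ℕ) : ℝ) • u‖ < ε →
      τ (((n + 1 : ℕ) : ℝ) • u) = τ u ^ (n + 1) := by
    intro u n
    induction n with
    | zero => intro _; simp
    | succ n ih =>
      intro h
      rw [norm_smul, Real.norm_natCast] at h
      have hle : ∀ k : ℕ, k ≤ n + 2 → ‖(k : ℝ) • u‖ < ε := by
        intro k hk
        rw [norm_smul, Real.norm_natCast]
        refine lt_of_le_of_lt ?_ h
        gcongr
      have h1 := hle (n + 1) (by omega)
      have h2 : ‖u‖ < ε := by simpa using hle 1 (by omega)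
      have h3 : ((n + 1 + 1 : ℕ) : ℝ) • u = ((n + 1 : ℕ) : ℝ) • u + u := by
        push_cast
        rw [add_smul, one_smul]
      rw [h3, hτ _ _ h1 h2 (h3 ▸ hle (n + 2) le_rfl), ih h1, ← pow_succ]
  have hpow' : ∀ (u : V) (n : ℕ), 0 < n → ‖(n : ℝ) • u‖ < ε → τ ((n : ℝ) • u) = τ u ^ n := by
    intro u n hn h
    obtain ⟨m, rfl⟩ := Nat.exists_eq_succ_of_ne_zero hn.ne'
    exact hpow u m h
  have hindep : ∀ (v : V) (n m : ℕ), 0 < n → 0 < m → ‖(n : ℝ)⁻¹ • v‖ < ε → ‖(m : ℝ)⁻¹ • v‖ < ε →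
      τ ((n : ℝ)⁻¹ • v) ^ n = τ ((m : ℝ)⁻¹ • v) ^ m := by
    intro v n m hn hm h1 h2
    have hn' : (n : ℝ) ≠ 0 := by exact_mod_cast hn.ne'
    have hm' : (m : ℝ) ≠ 0 := by exact_mod_cast hm.ne'
    -- Both powers equal `τ u ^ (n * m)` for this common subdivision.
    set u := ((n : ℝ)⁻¹ * (m : ℝ)⁻¹) • v with hu
    have e1 : (n : ℝ)⁻¹ • v = (m : ℝ) • u := by
      rw [hu, smul_smul]; congr 1; field_simp
    have e2 : (m : ℝ)⁻¹ • v = (n : ℝ) • u := by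
      rw [hu, smul_smul]; congr 1; field_simp
    rw [e1, e2, hpow' u m hm (e1 ▸ h1), hpow' u n hn (e2 ▸ h2), ← pow_mul, ← pow_mul, mul_comm]
  have hN : ∀ (v : V) (n : ℕ), ‖v‖ / ε < n → 0 < n ∧ ‖(n : ℝ)⁻¹ • v‖ < ε := by
    intro v n h
    have hn : (0 : ℝ) < n := lt_of_le_of_lt (by positivity) h
    refine ⟨by exact_mod_cast hn, ?_⟩
    rw [norm_smul, norm_inv, Real.norm_natCast, inv_mul_lt_iff₀ hn]
    rwa [div_lt_iff₀ hε] at h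
  choose N hNlt using fun v : V => exists_nat_gt (‖v‖ / ε)
  have hT : ∀ (v : V) (n : ℕ), ‖v‖ / ε < n →
      τ ((N v : ℝ)⁻¹ • v) ^ N v = τ ((n : ℝ)⁻¹ • v) ^ n := by
    intro v n h
    obtain ⟨h1, h2⟩ := hN v n h
    obtain ⟨h3, h4⟩ := hN v _ (hNlt v)
    exact hindep v _ _ h3 h1 h4 h2
  refine ⟨fun v => τ ((N v : ℝ)⁻¹ • v) ^ N v, fun v w => ?_, fun v hv => ?_⟩
  · obtain ⟨n, hn⟩ := exists_nat_gt ((‖v‖ + ‖w‖) / ε)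
    have b1 : ‖v‖ / ε < n := lt_of_le_of_lt (by gcongr; linarith [norm_nonneg w]) hn
    have b2 : ‖w‖ / ε < n := lt_of_le_of_lt (by gcongr; linarith [norm_nonneg v]) hn
    have b3 : ‖v + w‖ / ε < n := lt_of_le_of_lt (by gcongr; exact norm_add_le v w) hn
    simp only
    rw [hT v n b1, hT w n b2, hT (v + w) n b3]
    obtain ⟨-, c1⟩ := hN v n b1
    obtain ⟨-, c2⟩ := hN w n b2
    obtain ⟨-, c3⟩ := hN (v + w) n b3
    rw [smul_add] at c3 ⊢
    -- The monoid need not be commutative; these two elements commute because addition in `V` does.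
    have hcomm : Commute (τ ((n : ℝ)⁻¹ • v)) (τ ((n : ℝ)⁻¹ • w)) := by
      change _ * _ = _ * _
      rw [← hτ _ _ c1 c2 c3, ← hτ _ _ c2 c1 (by rwa [add_comm]), add_comm]
    rw [hτ _ _ c1 c2 c3, hcomm.mul_pow]
  · simp only
    have := hT v 1 (by rwa [div_lt_iff₀ hε, Nat.cast_one, one_mul])
    rw [this]
    simp

/-! ### Flat structures and their developing maps -/

theorem norm_mul_of_mul_self {A : ℝ × ℝ} (hA : A * A = 1) (v : ℝ × ℝ) : ‖A * v‖ = ‖v‖ := by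
  have h1 : |A.1| = 1 := by
    have := congrArg Prod.fst hA
    exact by rcases mul_self_eq_one_iff.1 this with h | h <;> simp [h]
  have h2 : |A.2| = 1 := by
    have := congrArg Prod.snd hA
    exact by rcases mul_self_eq_one_iff.1 this with h | h <;> simp [h]
  simp [Prod.norm_def, h1, h2]

/-- Comparison at `w₀` and at a second point `w₀ + (t, t)`, displaced in both coordinates,
determines both coefficients. -/
theorem eq_and_eq_of_eventually_affine {A B b d w₀ : ℝ × ℝ}
    (h : ∀ᶠ w in 𝓝 w₀, A * w + b = B * w + d) : A = B ∧ b = d := by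
  have h0 := h.self_of_nhds
  have ht : Filter.Tendsto (fun t : ℝ => w₀ + (t, t)) (𝓝 0) (𝓝 w₀) := by
    have : Continuous fun t : ℝ => w₀ + (t, t) := by fun_prop
    simpa [← Prod.zero_eq_mk] using this.tendsto 0
  obtain ⟨t, ht1, ht0⟩ := ((ht.eventually h).filter_mono nhdsWithin_le_nhds |>.and
    (self_mem_nhdsWithin (a := (0 : ℝ)) (s := {0}ᶜ))).exists
  have ht0' : t ≠ 0 := ht0
  have hAB : A = B := by
    have e1 := congrArg Prod.fst ht1
    have e2 := congrArg Prod.snd ht1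
    have e3 := congrArg Prod.fst h0
    have e4 := congrArg Prod.snd h0
    simp only [Prod.fst_add, Prod.snd_add, Prod.fst_mul, Prod.snd_mul] at e1 e2 e3 e4
    refine Prod.ext (mul_right_cancel₀ ht0' ?_) (mul_right_cancel₀ ht0' ?_) <;> linarith
  subst hAB
  exact ⟨rfl, add_left_cancel h0⟩

/-- A flat structure on `X` whose coordinate changes are locally of the form
`(x, y) ↦ (± x + a, ± y + b)` (that is, `v ↦ A * v + b` with `A * A = 1` in the ring `ℝ × ℝ`), with
a chart around each point that contains a square of side `2 ε`. -/
structure FlatStructure (X : Type*) [TopologicalSpace X] (ε : ℝ) where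
  pos : 0 < ε
  chart : X → OpenPartialHomeomorph X (ℝ × ℝ)
  mem_source : ∀ p, p ∈ (chart p).source
  apply_self : ∀ p, chart p p = 0
  ball_subset : ∀ p, Metric.ball 0 ε ⊆ (chart p).target
  compatible : ∀ p q, ∀ x ∈ (chart p).source, x ∈ (chart q).source →
    ∃ A b : ℝ × ℝ, A * A = 1 ∧ ∀ᶠ x' in 𝓝 x, chart p x' = A * chart q x' + b

namespace FlatStructure

variable {X : Type*} [TopologicalSpace X] {ε : ℝ}

/-- The frames of a flat structure: points together with the directions of the two axes. -/
abbrev Frame (X : Type*) : Type _ := {s : X × (ℝ × ℝ) // s.2 * s.2 = 1}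

/-- Changing the directions of the axes. -/
def act (A : ℝ × ℝ) (hA : A * A = 1) (s : Frame X) : Frame X :=
  ⟨(s.1.1, A * s.1.2), by
    change A * s.1.2 * (A * s.1.2) = 1
    rw [mul_mul_mul_comm, hA, s.2, one_mul]⟩

variable (S : FlatStructure X ε)

/-- The exponential map of a frame, on the square of side `2 ε`. -/
def exp (s : Frame X) (v : ℝ × ℝ) : X := (S.chart s.1.1).symm (s.1.2 * v)

theorem mul_mem_target (s : Frame X) {v : ℝ × ℝ} (hv : ‖v‖ < ε) :
    s.1.2 * v ∈ (S.chart s.1.1).target :=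
  S.ball_subset _ (by rwa [mem_ball_zero_iff, norm_mul_of_mul_self s.2])

theorem exp_zero (s : Frame X) : S.exp s 0 = s.1.1 := by
  rw [exp, mul_zero, ← S.apply_self s.1.1, (S.chart s.1.1).left_inv (S.mem_source _)]

theorem exp_mem_source (s : Frame X) {v : ℝ × ℝ} (hv : ‖v‖ < ε) :
    S.exp s v ∈ (S.chart s.1.1).source :=
  (S.chart s.1.1).map_target (S.mul_mem_target s hv)

theorem chart_exp (s : Frame X) {v : ℝ × ℝ} (hv : ‖v‖ < ε) :
    S.chart s.1.1 (S.exp s v) = s.1.2 * v :=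
  (S.chart s.1.1).right_inv (S.mul_mem_target s hv)

theorem continuousAt_exp (s : Frame X) {v : ℝ × ℝ} (hv : ‖v‖ < ε) : ContinuousAt (S.exp s) v :=
  ContinuousAt.comp (f := fun v => s.1.2 * v) (g := (S.chart s.1.1).symm)
    ((S.chart s.1.1).continuousAt_symm (S.mul_mem_target s hv)) (by fun_prop)

theorem exp_act {A : ℝ × ℝ} (hA : A * A = 1) (s : Frame X) (v : ℝ × ℝ) :
    S.exp (act A hA s) v = S.exp s (A * v) := by
  simp only [exp, act]
  congr 1
  ring

theorem eventually_norm_lt {v : ℝ × ℝ} (hv : ‖v‖ < ε) : ∀ᶠ w in 𝓝 v, ‖w‖ < ε :=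
  continuous_norm.continuousAt.eventually_lt continuousAt_const hv

theorem eventually_norm_add_lt {v w : ℝ × ℝ} (hv : ‖v + w‖ < ε) : ∀ᶠ w' in 𝓝 w, ‖v + w'‖ < ε :=
  ContinuousAt.eventually_lt (by fun_prop) continuousAt_const hv

theorem frame_ext {s s' : Frame X} (h : ∀ᶠ w in 𝓝 0, S.exp s w = S.exp s' w) : s = s' := by
  obtain ⟨⟨p, A⟩, hA⟩ := s
  obtain ⟨⟨p', A'⟩, hA'⟩ := s'
  have h0 := h.self_of_nhds
  rw [exp_zero, exp_zero] at h0
  simp only at h0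
  subst h0
  have h1 : ∀ᶠ w in 𝓝 (0 : ℝ × ℝ), A * w + 0 = A' * w + 0 := by
    filter_upwards [h, eventually_norm_lt (v := 0) (by simpa using S.pos)] with w hw hw'
    have := congrArg (S.chart p) hw
    rw [S.chart_exp ⟨(p, A), hA⟩ hw', S.chart_exp ⟨(p, A'), hA'⟩ hw'] at this
    simpa using this
  obtain ⟨rfl, -⟩ := eq_and_eq_of_eventually_affine h1
  rfl

/-- The frame is carried to the point `S.exp s v`; its axes are rewritten in the chart centred
there, which changes them by the signs `B`. -/
theorem exists_translate (s : Frame X) {v : ℝ × ℝ} (hv : ‖v‖ < ε) :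
    ∃ s' : Frame X, ∀ᶠ w in 𝓝 0, S.exp s (v + w) = S.exp s' w := by
  set p := S.exp s v with hp
  obtain ⟨B, d, hB, h⟩ := S.compatible p s.1.1 p (S.mem_source p) (S.exp_mem_source s hv)
  have hd : d = -(B * (s.1.2 * v)) := by
    have := h.self_of_nhds
    rw [S.apply_self, hp, S.chart_exp s hv] at this
    exact eq_neg_of_add_eq_zero_right this.symm
  have hc : Filter.Tendsto (fun w => S.exp s (v + w)) (𝓝 0) (𝓝 p) := by
    have h1 : ContinuousAt (fun w => S.exp s (v + w)) 0 :=
      ContinuousAt.comp (f := fun w => v + w) (g := S.exp s)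
        (by simpa using S.continuousAt_exp s hv) (by fun_prop)
    simpa [ContinuousAt] using h1
  refine ⟨⟨(p, B * s.1.2), by
    change B * s.1.2 * (B * s.1.2) = 1
    rw [mul_mul_mul_comm, hB, s.2, one_mul]⟩, ?_⟩
  filter_upwards [hc.eventually h, eventually_norm_add_lt (v := v) (w := 0) (by simpa using hv),
    hc ((S.chart p).open_source.mem_nhds (S.mem_source p))] with w h1 h2 h3
  rw [S.chart_exp s h2, hd] at h1
  refine ((S.chart p).left_inv h3).symm.trans ?_
  rw [h1]
  simp only [exp]
  congr 1
  ring

/-- Identity principle: both sides are affine in charts, and they agree near `0`. The overlap of the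
two squares is convex, hence connected, and at a limit point of the set of agreement the affine
coefficients must coincide. -/
theorem exp_add_eq [T2Space X] {s s' : Frame X} {v : ℝ × ℝ} (hv : ‖v‖ < ε)
    (h : ∀ᶠ w in 𝓝 0, S.exp s (v + w) = S.exp s' w) {w : ℝ × ℝ} (hw : ‖w‖ < ε) (hvw : ‖v + w‖ < ε) :
    ∀ᶠ w' in 𝓝 w, S.exp s (v + w') = S.exp s' w' := by
  set W : Set (ℝ × ℝ) := Metric.ball 0 ε ∩ Metric.ball (-v) ε
  have hWmem : ∀ w, w ∈ W ↔ ‖w‖ < ε ∧ ‖v + w‖ < ε := by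
    intro w
    simp only [W, Set.mem_inter_iff, mem_ball_iff_norm, sub_neg_eq_add, add_comm, sub_zero]
  have hW : IsPreconnected W :=
    ((convex_ball (0 : ℝ × ℝ) ε).inter (convex_ball (-v) ε)).isPreconnected
  set P : Set (ℝ × ℝ) := {w | ∀ᶠ w' in 𝓝 w, S.exp s (v + w') = S.exp s' w'}
  have hP : IsOpen P := isOpen_setOfPred_eventually_nhds
  have key : W ⊆ P := by
    refine hW.subset_of_closure_inter_subset hP ⟨0, ?_, h⟩ ?_
    · rw [hWmem]; simpa using ⟨S.pos, hv⟩
    rintro w ⟨hwP, hwW⟩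
    obtain ⟨hw1, hw2⟩ := (hWmem w).1 hwW
    have hc1 : ContinuousAt (fun w' => S.exp s (v + w')) w :=
      ContinuousAt.comp (f := fun w => v + w) (g := S.exp s) (S.continuousAt_exp s hw2) (by fun_prop)
    have hc2 := S.continuousAt_exp s' hw1
    have hfreq : ∃ᶠ w' in 𝓝 w, w' ∈ P := mem_closure_iff_frequently.1 hwP
    have heq : S.exp s (v + w) = S.exp s' w := by
      by_contra hne
      have hev : ∀ᶠ w' in 𝓝 w, S.exp s (v + w') ≠ S.exp s' w' := by
        exact (hc1.prodMk_nhds hc2).eventually (isOpen_ne_fun continuous_fst continuous_snd |>.mem_nhds hne)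
      obtain ⟨w', h1, h2⟩ := (hfreq.and_eventually hev).exists
      exact h2 h1.self_of_nhds
    have hx : S.exp s' w ∈ (S.chart s.1.1).source := heq ▸ S.exp_mem_source s hw2
    obtain ⟨A, b, hA, hAb⟩ := S.compatible s.1.1 s'.1.1 _ hx (S.exp_mem_source s' hw1)
    have hev : ∀ᶠ w' in 𝓝 w, S.chart s.1.1 (S.exp s' w') = A * (s'.1.2 * w') + b := by
      filter_upwards [hc2.eventually hAb, eventually_norm_lt hw1] with w' h1 h2
      rw [h1, S.chart_exp s' h2]
    obtain ⟨w₁, g1, g2, g3⟩ := (hfreq.and_eventually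
      (hev.eventually_nhds.and (eventually_norm_add_lt hw2).eventually_nhds)).exists
    have haff : ∀ᶠ w' in 𝓝 w₁, s.1.2 * w' + s.1.2 * v = (A * s'.1.2) * w' + b := by
      filter_upwards [g1, g2, g3] with w' k1 k2 k3
      rw [← k1, S.chart_exp s k3] at k2
      rw [mul_assoc, ← k2]
      ring
    obtain ⟨e1, e2⟩ := eq_and_eq_of_eventually_affine haff
    filter_upwards [hev, hc2 ((S.chart s.1.1).open_source.mem_nhds hx)] with w' k1 k2
    rw [← (S.chart s.1.1).left_inv k2, k1]
    simp only [exp]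
    congr 1
    rw [← mul_assoc, ← e1, ← e2]
    ring
  exact key ((hWmem w).2 ⟨hw, hvw⟩)

/-- Translation of frames by short vectors. -/
noncomputable def translate (v : ℝ × ℝ) : Function.End (Frame X) := fun s =>
  -- The value for long vectors is a mere default. On points alone a translation would be ambiguous
  -- up to signs; carrying the axes along makes it single-valued.
  if h : ‖v‖ < ε then (S.exists_translate s h).choose else s

theorem exp_translate [T2Space X] (s : Frame X) {v w : ℝ × ℝ} (hv : ‖v‖ < ε) (hw : ‖w‖ < ε)
    (hvw : ‖v + w‖ < ε) : ∀ᶠ w' in 𝓝 w, S.exp s (v + w') = S.exp (S.translate v s) w' := by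
  refine S.exp_add_eq hv ?_ hw hvw
  rw [translate, dif_pos hv]
  exact (S.exists_translate s hv).choose_spec

theorem translate_eq_iff [T2Space X] (s s' : Frame X) {v : ℝ × ℝ} (hv : ‖v‖ < ε) :
    S.translate v s = s' ↔ ∀ᶠ w in 𝓝 0, S.exp s (v + w) = S.exp s' w := by
  have h1 := S.exp_translate s hv (w := 0) (by simpa using S.pos) (by simpa using hv)
  constructor
  · rintro rfl
    exact h1
  · intro h
    apply S.frame_ext
    filter_upwards [h, h1] with w h2 h3
    rw [← h2, ← h3]

/-- This is flatness: translating in two steps or in one gives frames with the same germ of the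
exponential map, and that germ determines the frame. -/
theorem translate_add [T2Space X] (v w : ℝ × ℝ) (hv : ‖v‖ < ε) (hw : ‖w‖ < ε) (hvw : ‖v + w‖ < ε) :
    S.translate (v + w) = S.translate v * S.translate w := by
  funext s
  rw [S.translate_eq_iff _ _ hvw]
  change ∀ᶠ u in 𝓝 0, S.exp s (v + w + u) = S.exp (S.translate v (S.translate w s)) u
  have h1 := S.exp_translate s hw hv (by rwa [add_comm])
  have h2 := S.exp_translate (S.translate w s) hv (w := 0) (by simpa using S.pos) (by simpa using hv)
  have ht : Filter.Tendsto (fun u => v + u) (𝓝 0) (𝓝 v) := by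
    have : Continuous fun u : ℝ × ℝ => v + u := by fun_prop
    simpa using this.tendsto 0
  filter_upwards [ht.eventually h1, h2] with u h3 h4
  rw [← h4, ← h3]
  congr 1
  ring

theorem translate_act [T2Space X] {A : ℝ × ℝ} (hA : A * A = 1) (s : Frame X) {v : ℝ × ℝ}
    (hv : ‖v‖ < ε) : S.translate v (act A hA s) = act A hA (S.translate (A * v) s) := by
  rw [S.translate_eq_iff _ _ hv]
  have h1 := S.exp_translate s (v := A * v) (w := 0) (by rwa [norm_mul_of_mul_self hA])
    (by simpa using S.pos) (by rwa [add_zero, norm_mul_of_mul_self hA])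
  have ht : Filter.Tendsto (fun u => A * u) (𝓝 0) (𝓝 0) := by
    have : Continuous fun u : ℝ × ℝ => A * u := by fun_prop
    simpa using this.tendsto 0
  filter_upwards [ht.eventually h1] with u h2
  rw [exp_act, exp_act, ← h2, mul_add]

/-- The developing map of a flat structure: an exponential map defined on the whole plane, through
which all paths can be lifted, and which is equivariant up to signs. -/
theorem exists_developing [T2Space X] (S : FlatStructure X ε) (p : X) : ∃ E : ℝ × ℝ → X, Continuous E ∧ E 0 = p ∧
    (∀ v₀ v₁, E v₀ = E v₁ → ∃ A : ℝ × ℝ, A * A = 1 ∧ ∀ w, E (v₁ + w) = E (v₀ + A * w)) ∧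
    ∀ α : C(unitInterval, X), α 0 = p → ∃ v : unitInterval → ℝ × ℝ, Continuous v ∧ v 0 = 0 ∧
      ∀ t, E (v t) = α t := by
  -- Completeness: since `ε` is the same at all points, short translations extend to an action `T`
  -- of the whole plane on frames. The developing map is the base point of `T v s₀`.
  obtain ⟨T, hTadd, hTτ⟩ := exists_extension_of_local_hom S.pos S.translate S.translate_add
  have hT0 : ∀ s, T 0 s = s := by
    intro s
    rw [hTτ 0 (by simpa using S.pos), S.translate_eq_iff _ _ (by simpa using S.pos)]
    simp
  have hTadd' : ∀ v w s, T (v + w) s = T w (T v s) := fun v w s => by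
    rw [add_comm, hTadd]; rfl
  have hTact : ∀ {A : ℝ × ℝ} (hA : A * A = 1) (v : ℝ × ℝ) (s : Frame X),
      T v (act A hA s) = act A hA (T (A * v) s) := by
    intro A hA v s
    have hn : ∀ (n : ℕ) (u : ℝ × ℝ), ‖u‖ < ε → ∀ s,
        T ((n : ℝ) • u) (act A hA s) = act A hA (T (A * ((n : ℝ) • u)) s) := by
      intro n u hu
      induction n with
      | zero => intro s; simp [hT0]
      | succ n ih =>
        intro s
        push_cast
        rw [add_smul, one_smul, mul_add, hTadd', hTadd', ih, hTτ u hu, S.translate_act hA _ hu,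
          hTτ (A * u) (by rwa [norm_mul_of_mul_self hA])]
    obtain ⟨n, hn'⟩ := exists_nat_gt (‖v‖ / ε)
    have hnpos : (0 : ℝ) < n := lt_of_le_of_lt (div_nonneg (norm_nonneg _) S.pos.le) hn'
    have hsmall : ‖(n : ℝ)⁻¹ • v‖ < ε := by
      rw [norm_smul, norm_inv, Real.norm_natCast, inv_mul_lt_iff₀ hnpos]
      rwa [div_lt_iff₀ S.pos] at hn'
    have := hn n _ hsmall s
    rwa [smul_smul, mul_inv_cancel₀ hnpos.ne', one_smul] at this
  set s₀ : Frame X := ⟨(p, 1), one_mul 1⟩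
  have hbase : ∀ (s : Frame X) (w : ℝ × ℝ), ‖w‖ < ε → (T w s).1.1 = S.exp s w := by
    intro s w hw
    have := (S.exp_translate s hw (w := 0) (by simpa using S.pos) (by simpa using hw)).self_of_nhds
    rw [add_zero, exp_zero] at this
    rw [hTτ w hw, this]
  have hloc : ∀ (v w : ℝ × ℝ), ‖w‖ < ε → (T (v + w) s₀).1.1 = S.exp (T v s₀) w := by
    intro v w hw
    rw [hTadd', hbase _ _ hw]
  refine ⟨fun v => (T v s₀).1.1, ?_, congrArg (fun s : Frame X => s.1.1) (hT0 s₀), ?_, ?_⟩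
  · rw [continuous_iff_continuousAt]
    intro v
    have h1 : ContinuousAt (fun w => S.exp (T v s₀) (w - v)) v :=
      ContinuousAt.comp (f := fun w => w - v) (g := S.exp (T v s₀))
        (by simpa using S.continuousAt_exp (T v s₀) (v := 0) (by simpa using S.pos)) (by fun_prop)
    refine h1.congr ?_
    have : ∀ᶠ w in 𝓝 v, ‖w - v‖ < ε :=
      ContinuousAt.eventually_lt (by fun_prop) continuousAt_const (by simpa using S.pos)
    filter_upwards [this] with w hw
    rw [← hloc v _ hw, add_sub_cancel]
  -- Two frames at the same point differ by signs. Each direction is its own inverse, so the product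
  -- of the two is the required `A`, and the equivariance `hTact` does the rest.
  · intro v₀ v₁ h
    have hA : (T v₁ s₀).1.2 * (T v₀ s₀).1.2 * ((T v₁ s₀).1.2 * (T v₀ s₀).1.2) = 1 := by
      rw [mul_mul_mul_comm, (T v₁ s₀).2, (T v₀ s₀).2, one_mul]
    obtain ⟨A, hAdef⟩ : ∃ A, A = (T v₁ s₀).1.2 * (T v₀ s₀).1.2 := ⟨_, rfl⟩
    rw [← hAdef] at hA
    refine ⟨A, hA, fun w => ?_⟩
    have h1 : T v₁ s₀ = act A hA (T v₀ s₀) := by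
      apply Subtype.ext
      refine Prod.ext h.symm ?_
      change _ = A * (T v₀ s₀).1.2
      rw [hAdef, mul_assoc, (T v₀ s₀).2, mul_one]
    simp only
    rw [hTadd', hTadd', h1, hTact]
    rfl
  · intro α hα
    set E := fun v => (T v s₀).1.1
    let P : unitInterval → unitInterval → Prop := fun a b => ∀ v₀, E v₀ = α a →
      ∃ v : unitInterval → ℝ × ℝ, ContinuousOn v (Set.Icc a b) ∧ v a = v₀ ∧
        ∀ t ∈ Set.Icc a b, E (v t) = α t
    have hPlocal : ∀ t₀, ∃ N : Set unitInterval, IsOpen N ∧ t₀ ∈ N ∧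
        ∀ a b, a ≤ b → Set.Icc a b ⊆ N → P a b := by
      intro t₀
      set q := α t₀
      set ψ := S.chart q
      -- Radius `ε / 2` makes differences of chart coordinates shorter than `ε`, so the lift can be
      -- written down in a single chart.
      set N : Set unitInterval := α ⁻¹' (ψ.source ∩ ψ ⁻¹' Metric.ball 0 (ε / 2))
      have hsrc : ∀ t ∈ N, α t ∈ ψ.source := fun t ht => ht.1
      refine ⟨N, (ψ.isOpen_inter_preimage Metric.isOpen_ball).preimage α.continuous,
        ⟨S.mem_source q, by
          rw [Set.mem_preimage, S.apply_self]; exact Metric.mem_ball_self (half_pos S.pos)⟩, ?_⟩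
      intro a b hab hN v₀ hv₀
      have haN := hN ⟨le_rfl, hab⟩
      have hnorm : ∀ t ∈ N, ‖ψ (α t)‖ < ε / 2 := fun t ht => by simpa using ht.2
      set x := ψ (α a)
      have hx : ‖x‖ < ε := (hnorm a haN).trans (half_lt_self S.pos)
      let sq : Frame X := ⟨(q, 1), one_mul 1⟩
      have hexp : ∀ u, S.exp sq u = ψ.symm u := fun u => by simp [exp, sq, ψ]
      set s₁ := S.translate x sq
      have hs₁ : s₁.1.1 = α a := by
        have := (S.exp_translate sq hx (w := 0) (by simpa using S.pos)
          (by simpa using hx)).self_of_nhds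
        rw [add_zero, exp_zero, hexp, ψ.left_inv haN.1] at this
        exact this.symm
      set s := T v₀ s₀
      have hA : s.1.2 * s₁.1.2 * (s.1.2 * s₁.1.2) = 1 := by
        rw [mul_mul_mul_comm, s.2, s₁.2, one_mul]
      set A := s.1.2 * s₁.1.2 with hAdef
      have hs : s = act A hA s₁ := by
        apply Subtype.ext
        refine Prod.ext (hv₀.trans hs₁.symm) ?_
        change _ = s.1.2 * s₁.1.2 * s₁.1.2
        rw [mul_assoc, s₁.2, mul_one]
      refine ⟨fun t => v₀ + A * (ψ (α t) - x), ?_, by simp [x], fun t ht => ?_⟩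
      · have h1 : ContinuousOn (fun t => ψ (α t)) (Set.Icc a b) :=
          ψ.continuousOn.comp α.continuous.continuousOn fun t ht => hsrc t (hN ht)
        exact continuousOn_const.add (continuousOn_const.mul (h1.sub continuousOn_const))
      · have htN := hN ht
        have hw : ‖ψ (α t) - x‖ < ε :=
          (norm_sub_le _ _).trans_lt (by linarith [hnorm t htN, hnorm a haN])
        rw [show E (v₀ + A * (ψ (α t) - x)) = S.exp s (A * (ψ (α t) - x)) from
          hloc v₀ _ (by rwa [norm_mul_of_mul_self hA]), hs, exp_act, ← mul_assoc, hA, one_mul]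
        have h2 := (S.exp_translate sq hx hw (by
          rw [add_sub_cancel]
          exact (hnorm t htN).trans (half_lt_self S.pos))).self_of_nhds
        rw [← h2, add_sub_cancel, hexp, ψ.left_inv (hsrc t htN)]
    have hPtrans : ∀ a b c, a ≤ b → b ≤ c → P a b → P b c → P a c := by
      intro a b c hab hbc h1 h2 v₀ hv₀
      obtain ⟨v, hv, hva, hvE⟩ := h1 v₀ hv₀
      obtain ⟨v', hv', hvb, hvE'⟩ := h2 (v b) (hvE b ⟨hab, le_rfl⟩)
      refine ⟨fun t => if t ≤ b then v t else v' t, ?_, by simp [hab, hva], fun t ht => ?_⟩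
      · rw [← Set.Icc_union_Icc_eq_Icc hab hbc]
        refine ContinuousOn.union_of_isClosed ?_ ?_ isClosed_Icc isClosed_Icc
        · exact hv.congr fun t ht => by simp [ht.2]
        · refine hv'.congr fun t ht => ?_
          by_cases htb : t ≤ b
          · have : t = b := le_antisymm htb ht.1
            subst this
            simp [hvb]
          · simp [htb]
      · by_cases htb : t ≤ b
        · simp only [htb, if_true]
          exact hvE t ⟨ht.1, htb⟩
        · simp only [htb, if_false]
          exact hvE' t ⟨(not_le.1 htb).le, ht.2⟩
    choose N hNo hNt hNP using hPlocal
    obtain ⟨t, ht0, htm, ⟨n, hn⟩, htN⟩ := exists_monotone_Icc_subset_open_cover_unitInterval hNo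
      (fun s _ => Set.mem_iUnion.2 ⟨s, hNt s⟩)
    have key : ∀ m, P 0 (t m) := by
      intro m
      induction m with
      | zero =>
        rw [ht0]
        intro v₀ hv₀
        refine ⟨fun _ => v₀, continuousOn_const, rfl, fun s hs => ?_⟩
        have : s = 0 := le_antisymm hs.2 hs.1
        rw [this, hv₀]
      | succ m ih =>
        obtain ⟨i, hi⟩ := htN m
        exact hPtrans _ _ _ (ht0 ▸ htm (Nat.zero_le m)) (htm m.le_succ) ih
          (hNP i _ _ (htm m.le_succ) hi)
    obtain ⟨v, hv, hv0, hvE⟩ := key n 0 (by simp only [E]; rw [hT0, hα])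
    rw [hn n le_rfl, show Set.Icc (0 : unitInterval) 1 = Set.univ from
      Set.eq_univ_of_forall fun s => ⟨unitInterval.nonneg', unitInterval.le_one'⟩] at hv hvE
    exact ⟨v, continuousOn_univ.1 hv, hv0, fun t => hvE t trivial⟩

end FlatStructure

/-! ### Winding numbers obstruct flat structures -/

/-- The difference of two logarithms of one function is continuous with values in `2πiℤ`, hence
constant. -/
theorem sub_eq_sub_of_exp_eq {T : Type*} [TopologicalSpace T] [PreconnectedSpace T] {u v : T → ℂ}
    (hu : Continuous u) (hv : Continuous v) (h : ∀ t, Complex.exp (u t) = Complex.exp (v t))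
    (s t : T) : u s - v s = u t - v t := by
  refine isPreconnected_univ.induction₂ (s := Set.univ) (fun s t => u s - v s = u t - v t)
    (fun x _ => ?_) (fun _ _ _ _ _ _ h1 h2 => h1.trans h2) (fun _ _ _ _ h1 => h1.symm)
    trivial trivial
  rw [nhdsWithin_univ]
  have hc : ContinuousAt (fun y => ‖(u x - v x) - (u y - v y)‖) x := by fun_prop
  filter_upwards [hc.eventually_lt (g := fun _ => 2 * Real.pi) continuousAt_const
    (by simp [Real.pi_pos])] with y hy
  obtain ⟨n, hn⟩ := Complex.exp_eq_exp_iff_exists_int.1 (h x)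
  obtain ⟨m, hm⟩ := Complex.exp_eq_exp_iff_exists_int.1 (h y)
  have hd : (u x - v x) - (u y - v y) = ((n - m : ℤ) : ℂ) * (2 * Real.pi * Complex.I) := by
    rw [hn, hm]; push_cast; ring
  rw [hd, norm_mul, Complex.norm_intCast] at hy
  have h2 : ‖(2 * Real.pi * Complex.I : ℂ)‖ = 2 * Real.pi := by
    simp [abs_of_pos Real.pi_pos]
  rw [h2] at hy
  have h3 : |((n - m : ℤ) : ℝ)| < 1 := by
    by_contra hcon
    nlinarith [Real.pi_pos]
  have h4 : n - m = 0 := by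
    rw [← Int.cast_abs] at h3
    exact Int.abs_lt_one_iff.1 (by exact_mod_cast h3)
  rw [h4, Int.cast_zero, zero_mul] at hd
  exact sub_eq_zero.1 hd

/-- Three vectors of the plane have small non-trivial integral combinations. -/
theorem exists_small_int_combination (γ : Fin 3 → ℝ × ℝ) {δ : ℝ} (hδ : 0 < δ) :
    ∃ n : Fin 3 → ℤ, n ≠ 0 ∧ ‖∑ m, n m • γ m‖ < δ := by
  -- Otherwise the three vectors would generate a discrete subgroup of rank three in a plane.
  by_contra! hcon
  have key : ∀ n : Fin 3 → ℤ, ‖∑ m, n m • γ m‖ < δ → n = 0 := fun n hn => by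
    by_contra h0
    exact absurd hn (not_lt.2 (hcon n h0))
  have hli : LinearIndependent ℤ γ := by
    rw [Fintype.linearIndependent_iff]
    intro n hn i
    rw [key n (by rw [hn]; simpa using hδ)]
    rfl
  have hdisc : DiscreteTopology (Submodule.span ℤ (Set.range γ)) := by
    refine discreteTopology_of_isOpen_singleton_zero (Metric.isOpen_singleton_iff.2 ⟨δ, hδ, ?_⟩)
    rintro ⟨y, hy⟩ hyd
    obtain ⟨n, rfl⟩ := (Submodule.mem_span_range_iff_exists_fun ℤ).1 hy
    have h1 : ‖∑ m, n m • γ m‖ < δ := by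
      have h2 : dist (∑ m, n m • γ m) 0 < δ := hyd
      rwa [dist_zero_right] at h2
    apply Subtype.ext
    simp [key n h1]
  have h1 := Real.finrank_eq_int_finrank_of_discrete hdisc
  have h2 : Set.finrank ℤ (Set.range γ) = 3 := by
    rw [Set.finrank, finrank_span_eq_card hli]; simp
  have h3 : Set.finrank ℝ (Set.range γ) ≤ 2 := by
    have := Submodule.finrank_le (Submodule.span ℝ (Set.range γ))
    simpa [Set.finrank] using this
  omega

/-- A surface with three loops that have independent winding numbers with respect to three
non-vanishing functions has no flat structure. -/
theorem FlatStructure.false_of_windings {X : Type*} [TopologicalSpace X] [T2Space X] {ε : ℝ}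
    (S : FlatStructure X ε) {p : X} {w : Fin 3 → X → ℂ} (hw : ∀ j, Continuous (w j))
    (hw0 : ∀ j x, w j x ≠ 0) {α : Fin 3 → C(unitInterval, X)} (hα0 : ∀ m, α m 0 = p)
    (hα1 : ∀ m, α m 1 = p) {L : Fin 3 → Fin 3 → unitInterval → ℂ} (hL : ∀ m j, Continuous (L m j))
    (hexp : ∀ m j t, Complex.exp (L m j t) = w j (α m t))
    (hdiff : ∀ m j, L m j 1 - L m j 0 = if j ≤ m then 2 * Real.pi * Complex.I else 0) : False := by
  obtain ⟨E, hE, hE0, hEA, hElift⟩ := S.exists_developing p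
  have hlog : ∀ j, ∃ h : ℝ × ℝ → ℂ, Continuous h ∧ ∀ v, Complex.exp (h v) = w j (E v) := by
    intro j
    obtain ⟨f, ⟨-, hf⟩, -⟩ := Complex.isCoveringMapOn_exp.existsUnique_continuousMap_lifts
      ⟨fun v => w j (E v), (hw j).comp hE⟩ (a₀ := (0 : ℝ × ℝ)) (Complex.exp_log (hw0 j (E 0)))
      (fun v => hw0 j _)
    exact ⟨f, f.continuous, fun v => congrFun hf v⟩
  choose h hc hh using hlog
  set W : Fin 3 → Fin 3 → ℂ := fun m j => if j ≤ m then 2 * Real.pi * Complex.I else 0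
  -- The end of a lift of the loop gives a symmetry `u ↦ v 1 + A * u` of `E`, which adds the winding
  -- `W m j` to each logarithm. Its square is a translation since `A * A = 1`, at the price of the
  -- factor `2`.
  have hperiod : ∀ m, ∃ γ : ℝ × ℝ, ∀ j v, h j (v + γ) = h j v + 2 * W m j := by
    intro m
    obtain ⟨v, hv, hv0, hvE⟩ := hElift (α m) (hα0 m)
    obtain ⟨A, hA, hAE⟩ := hEA 0 (v 1) (by rw [hE0, hvE, hα1])
    have hf : ∀ u, E (v 1 + A * u) = E u := fun u => by
      rw [hAE, zero_add, ← mul_assoc, hA, one_mul]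
    have hstep : ∀ j u, h j (v 1 + A * u) = h j u + W m j := by
      intro j u
      have h1 := sub_eq_sub_of_exp_eq (u := fun u => h j (v 1 + A * u)) (v := h j)
        ((hc j).comp (by fun_prop)) (hc j) (fun u => by rw [hh, hh, hf]) u 0
      have h2 := sub_eq_sub_of_exp_eq (u := fun t => h j (v t)) (v := L m j)
        ((hc j).comp hv) (hL m j) (fun t => by rw [hh, hexp, hvE]) 1 0
      simp only [mul_zero, add_zero] at h1
      rw [hv0] at h2
      have h3 : h j (v 1) - h j 0 = W m j := by
        rw [show W m j = _ from (hdiff m j).symm]; linear_combination h2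
      linear_combination h1 + h3
    refine ⟨v 1 + A * v 1, fun j u => ?_⟩
    have : u + (v 1 + A * v 1) = v 1 + A * (v 1 + A * u) := by
      rw [mul_add, ← mul_assoc, hA, one_mul]; ring
    rw [this, hstep, hstep]
    ring
  choose γ hγ using hperiod
  let H : AddSubgroup ((ℝ × ℝ) × (Fin 3 → ℂ)) :=
    { carrier := {x | ∀ j v, h j (v + x.1) = h j v + x.2 j}
      zero_mem' := fun j v => by simp
      add_mem' := fun {x y} hx hy j v => by
        rw [Prod.fst_add, Prod.snd_add, ← add_assoc, hy, hx, Pi.add_apply, add_assoc]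
      neg_mem' := fun {x} hx j v => by
        have := hx j (v + -x.1)
        rw [neg_add_cancel_right] at this
        rw [Prod.fst_neg, Prod.snd_neg, Pi.neg_apply, this]
        ring }
  have hmem : ∀ n : Fin 3 → ℤ, ∑ m, n m • (γ m, fun j => 2 * W m j) ∈ H := fun n =>
    H.sum_mem fun m _ => H.zsmul_mem (fun j v => hγ m j v) _
  have hsum : ∀ (n : Fin 3 → ℤ) j,
      h j (∑ m, n m • γ m) = h j 0 + ∑ m, (n m : ℂ) * (2 * W m j) := by
    intro n j
    have := hmem n j 0
    simpa [Prod.fst_sum, Prod.snd_sum] using this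
  have hcont : ∀ᶠ v in 𝓝 (0 : ℝ × ℝ), ∀ j, ‖h j v - h j 0‖ < 4 * Real.pi := by
    rw [Filter.eventually_all]
    intro j
    have hc' : ContinuousAt (fun v => ‖h j v - h j 0‖) 0 :=
      (((hc j).sub continuous_const).norm).continuousAt
    exact hc'.eventually_lt continuousAt_const (by simp [Real.pi_pos])
  obtain ⟨δ, hδ, hδh⟩ := Metric.eventually_nhds_iff.1 hcont
  obtain ⟨n, hn0, hn⟩ := exists_small_int_combination γ hδ
  have hsmall := hδh (y := ∑ m, n m • γ m) (by rwa [dist_zero_right])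
  -- The combination is so short that the logarithms change by less than `4π`; a change by an
  -- integral multiple of `4πi` is therefore zero.
  have hzero : ∀ (j : Fin 3) (k : ℤ),
      ∑ m, (n m : ℂ) * (2 * W m j) = (k : ℂ) * (4 * Real.pi * Complex.I) → k = 0 := by
    intro j k hk
    have h1 := hsmall j
    rw [hsum, add_sub_cancel_left, hk, norm_mul, Complex.norm_intCast] at h1
    have h2 : ‖(4 * Real.pi * Complex.I : ℂ)‖ = 4 * Real.pi := by
      simp [abs_of_pos Real.pi_pos]
    rw [h2] at h1
    have h3 : |(k : ℝ)| < 1 := by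
      by_contra hcon
      nlinarith [Real.pi_pos]
    rw [← Int.cast_abs] at h3
    exact Int.abs_lt_one_iff.1 (by exact_mod_cast h3)
  -- The winding matrix is triangular, so the coefficients vanish one after the other from the last.
  have k2 := hzero 2 (n 2) (by
    simp only [Fin.sum_univ_three, W]
    rw [if_neg (by decide : ¬ (2 : Fin 3) ≤ 0),
      if_neg (by decide : ¬ (2 : Fin 3) ≤ 1),
      if_pos (by decide : (2 : Fin 3) ≤ 2)]
    ring)
  have k1 := hzero 1 (n 1 + n 2) (by
    simp only [Fin.sum_univ_three, W]
    rw [if_neg (by decide : ¬ (1 : Fin 3) ≤ 0),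
      if_pos (by decide : (1 : Fin 3) ≤ 1),
      if_pos (by decide : (1 : Fin 3) ≤ 2)]
    push_cast
    ring)
  have k0 := hzero 0 (n 0 + n 1 + n 2) (by
    simp only [Fin.sum_univ_three, W]
    rw [if_pos (by decide : (0 : Fin 3) ≤ 0),
      if_pos (by decide : (0 : Fin 3) ≤ 1),
      if_pos (by decide : (0 : Fin 3) ≤ 2)]
    push_cast
    ring)
  apply hn0
  funext i
  fin_cases i <;> simp <;> omega

/-! ### Flat structures from transverse foliations without singularities -/

theorem exists_affine_of_affineAlong {X : Type*} {l : Filter X} {u v : X → ℝ × ℝ}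
    (h1 : AffineAlong 1 l (fun x => (u x).1) (fun x => (v x).1))
    (h2 : AffineAlong 1 l (fun x => (u x).2) (fun x => (v x).2)) :
    ∃ A b : ℝ × ℝ, A * A = 1 ∧ ∀ᶠ x in l, u x = A * v x + b := by
  obtain ⟨ε, b, hε, h1⟩ := h1
  obtain ⟨ε', b', hε', h2⟩ := h2
  refine ⟨(ε, ε'), (b, b'), ?_, ?_⟩
  · rcases hε with rfl | rfl <;> rcases hε' with rfl | rfl <;> simp
  · filter_upwards [h1, h2] with x h3 h4
    simp only [one_mul] at h3 h4
    exact Prod.ext h3 h4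

section

variable {X : Type*} [TopologicalSpace X]

namespace SingularMeasuredFoliation

variable {F G : SingularMeasuredFoliation X}

/-- A chart whose coordinates are those of the common charts of `F` and `G`, up to signs and
translations. -/
def IsFlatChart (F G : SingularMeasuredFoliation X) (φ : OpenPartialHomeomorph X (ℝ × ℝ)) : Prop :=
  ∀ x ∈ φ.source, ∀ ψ, IsPairChart F G ψ → x ∈ ψ.source →
    ∃ A b : ℝ × ℝ, A * A = 1 ∧ ∀ᶠ x' in 𝓝 x, φ x' = A * ψ x' + b

/-- There is a flat chart centred at `p` that contains a square of side `2 δ`. -/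
def HasFlatBox (F G : SingularMeasuredFoliation X) (δ : ℝ) (p : X) : Prop :=
  ∃ φ, IsFlatChart F G φ ∧ p ∈ φ.source ∧ φ p = 0 ∧ Metric.ball 0 δ ⊆ φ.target

theorem IsPairChart.isFlatChart {φ : OpenPartialHomeomorph X (ℝ × ℝ)} (h : IsPairChart F G φ) :
    IsFlatChart F G φ := fun _ hx _ hψ hx' =>
  exists_affine_of_affineAlong (h.affineAlong_fst hψ hx hx') (affineAlong_charts h.1 hψ.1 hx hx')

theorem Transverse.eventually_hasFlatBox (h : F.Transverse G) {p : X} (hp : p ∉ F.sing) :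
    ∃ δ > 0, ∀ᶠ p' in 𝓝 p, HasFlatBox F G δ p' := by
  obtain ⟨φ, hφ, hpφ, hφ'⟩ := h.regular p hp
  obtain ⟨r, hr, hrφ⟩ := Metric.isOpen_iff.1 φ.open_target _ (φ.map_source hpφ)
  refine ⟨r / 2, half_pos hr, ?_⟩
  filter_upwards [φ.open_source.mem_nhds hpφ,
    φ.continuousAt hpφ (Metric.ball_mem_nhds _ (half_pos hr))] with p' h1 h2
  refine ⟨φ.transHomeomorph (Homeomorph.addRight (-φ p')), ?_, h1, by simp, ?_⟩
  · intro x hx ψ hψ hxψ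
    obtain ⟨A, b, hA, hb⟩ := IsPairChart.isFlatChart ⟨hφ, hφ'⟩ x hx ψ hψ hxψ
    refine ⟨A, b - φ p', hA, ?_⟩
    filter_upwards [hb] with x' hx'
    simp [hx']
    ring
  · intro v hv
    change (Homeomorph.addRight (-φ p')).symm v ∈ φ.target
    apply hrφ
    have h3 : ‖v‖ < r / 2 := by simpa using hv
    have h4 : ‖φ p' - φ p‖ < r / 2 := by simpa [dist_eq_norm] using h2
    have h5 : (Homeomorph.addRight (-φ p')).symm v = v + φ p' := by
      change v + - -φ p' = _
      rw [neg_neg]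
    rw [h5, Metric.mem_ball, dist_eq_norm, add_sub_assoc]
    exact (norm_add_le _ _).trans_lt (by linarith)

theorem HasFlatBox.of_homeomorph (h : F.Transverse G) {g : X ≃ₜ X} (hF : F.HasImage g 1 F)
    (hG : G.HasImage g 1 G) {δ : ℝ} {p : X} (hp : HasFlatBox F G δ (g p)) : HasFlatBox F G δ p := by
  obtain ⟨φ, hφ, hpφ, hφp, hball⟩ := hp
  refine ⟨g.transOpenPartialHomeomorph φ, ?_, hpφ, hφp, hball⟩
  intro x hx ψ hψ hxψ
  have hreg : g x ∉ F.sing := by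
    rw [hF.mem_sing_iff]; exact F.source_subset ψ hψ.1 hxψ
  obtain ⟨χ, hχ, hxχ, hχ'⟩ := h.regular _ hreg
  obtain ⟨A, b, hA, hAb⟩ := hφ (g x) hx χ ⟨hχ, hχ'⟩ hxχ
  obtain ⟨B, d, hB, hBd⟩ := exists_affine_of_affineAlong (u := fun x => χ (g x)) (v := ψ)
    (inv_one (G := ℝ) ▸ (hG.affineAlong hψ.2 hχ' hxψ hxχ).symm one_ne_zero)
    (inv_one (G := ℝ) ▸ (hF.affineAlong hψ.1 hχ hxψ hxχ).symm one_ne_zero)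
  refine ⟨A * B, A * d + b, by rw [mul_mul_mul_comm, hA, hB, one_mul], ?_⟩
  filter_upwards [g.continuous.continuousAt.eventually hAb, hBd] with x' h1 h2
  rw [Homeomorph.transOpenPartialHomeomorph_apply, Function.comp_apply, h1, h2]
  ring

/-- Two transverse foliations without singularities that are invariant under a cocompact set of
homeomorphisms define a flat structure. -/
theorem Transverse.exists_flatStructure (h : F.Transverse G) (hs : F.sing = ∅) {K : Set X}
    (hK : IsCompact K)
    (hg : ∀ x : X, ∃ g : X ≃ₜ X, g x ∈ K ∧ F.HasImage g 1 F ∧ G.HasImage g 1 G) :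
    ∃ ε, Nonempty (FlatStructure X ε) := by
  have hmono : ∀ {δ δ' : ℝ} {p : X}, δ' ≤ δ → HasFlatBox F G δ p → HasFlatBox F G δ' p := by
    rintro δ δ' p hle ⟨φ, h1, h2, h3, h4⟩
    exact ⟨φ, h1, h2, h3, (Metric.ball_subset_ball hle).trans h4⟩
  -- Compactness gives one box size on `K`, and the invariance of both foliations carries it to all
  -- points.
  obtain ⟨ε, hε, hεK⟩ : ∃ ε > 0, ∀ p ∈ K, HasFlatBox F G ε p := by
    refine hK.induction_on (p := fun S => ∃ ε > 0, ∀ p ∈ S, HasFlatBox F G ε p)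
      ⟨1, one_pos, by simp⟩ ?_ ?_ ?_
    · rintro S T hST ⟨ε, hε, hT⟩
      exact ⟨ε, hε, fun p hp => hT p (hST hp)⟩
    · rintro S T ⟨ε, hε, hS⟩ ⟨ε', hε', hT⟩
      refine ⟨min ε ε', lt_min hε hε', ?_⟩
      rintro p (hp | hp)
      · exact hmono (min_le_left _ _) (hS p hp)
      · exact hmono (min_le_right _ _) (hT p hp)
    · intro p _
      obtain ⟨δ, hδ, hev⟩ := h.eventually_hasFlatBox (p := p) (by simp [hs])
      exact ⟨_, nhdsWithin_le_nhds hev, δ, hδ, fun p hp => hp⟩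
  have hall : ∀ p, HasFlatBox F G ε p := by
    intro p
    obtain ⟨g, hgK, hF, hG⟩ := hg p
    exact (hεK _ hgK).of_homeomorph h hF hG
  choose φ hφ hmem hself hball using hall
  refine ⟨ε, ⟨hε, φ, hmem, hself, hball, ?_⟩⟩
  intro p q x hxp hxq
  obtain ⟨χ, hχ, hxχ, hχ'⟩ := h.regular x (by simp [hs])
  obtain ⟨A, b, hA, hAb⟩ := hφ p x hxp χ ⟨hχ, hχ'⟩ hxχ
  obtain ⟨B, d, hB, hBd⟩ := hφ q x hxq χ ⟨hχ, hχ'⟩ hxχ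
  refine ⟨A * B, b - A * B * d, by rw [mul_mul_mul_comm, hA, hB, one_mul], ?_⟩
  filter_upwards [hAb, hBd] with x' h1 h2
  rw [h1, h2, mul_add, mul_assoc A B (B * χ x'), ← mul_assoc B B, hB, one_mul]
  ring

end SingularMeasuredFoliation

end

noncomputable section

/-! ### Loops around the holes of the ladder -/

theorem one_sub_two_mul_le_cos {d : ℝ} (h0 : 0 ≤ d) (h1 : d ≤ 1 / 2) :
    1 - 2 * d ≤ Real.cos (Real.pi * d) := by
  have hpi := Real.pi_pos
  have := Real.mul_le_sin (x := Real.pi / 2 - Real.pi * d) (by nlinarith) (by nlinarith)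
  rw [Real.sin_pi_div_two_sub] at this
  refine le_trans (le_of_eq ?_) this
  field_simp

/-- Concavity of the cosine bounds the right-hand side below by `d (1 - d) + (1 - 2 d) ^ 2 = 1 / 4 +
3 (d - 1 / 2) ^ 2`. -/
theorem quarter_le_of_arc {d e : ℝ} (hd : 0 ≤ d) (hd' : d ≤ 1 / 2) (hde : 1 ≤ d + e) :
    1 / 4 ≤ d * e + Real.cos (Real.pi * d) ^ 2 := by
  have h1 := one_sub_two_mul_le_cos hd hd'
  have h2 : (1 - 2 * d) ^ 2 ≤ Real.cos (Real.pi * d) ^ 2 :=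
    pow_le_pow_left₀ (by linarith) h1 2
  have h3 : d * (1 - d) ≤ d * e := mul_le_mul_of_nonneg_left (by linarith) hd
  nlinarith [sq_nonneg (d - 1 / 2)]

/-- The circle with diameter from `(-1/2, 0)` to `(m + 1/2, 0)` misses the holes. Here `d` and `e`
are the horizontal distances to the two ends, so `y ^ 2 = d * e`; if both are at least `1 / 2` this
product suffices, and near an end `quarter_le_of_arc` applies. -/
theorem quarter_le_on_circle (m : ℕ) (θ : ℝ) :
    0 ≤ ((m + 1) / 2 * Real.sin θ) ^ 2 +
      Real.sin (Real.pi * (m / 2 - (m + 1) / 2 * Real.cos θ)) ^ 2 - 1 / 4 := by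
  set d : ℝ := (m + 1) / 2 * (1 - Real.cos θ) with hd
  set e : ℝ := (m + 1) / 2 * (1 + Real.cos θ) with he
  have hm : (0 : ℝ) ≤ m := Nat.cast_nonneg m
  have hd0 : 0 ≤ d := mul_nonneg (by positivity) (by linarith [Real.cos_le_one θ])
  have he0 : 0 ≤ e := mul_nonneg (by positivity) (by linarith [Real.neg_one_le_cos θ])
  have hsum : d + e = m + 1 := by rw [hd, he]; ring
  have hy : ((m + 1) / 2 * Real.sin θ) ^ 2 = d * e := by
    rw [mul_pow, Real.sin_sq, hd, he]; ring
  have hx : Real.sin (Real.pi * (m / 2 - (m + 1) / 2 * Real.cos θ)) ^ 2 =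
      Real.cos (Real.pi * d) ^ 2 := by
    have : Real.pi * (m / 2 - (m + 1) / 2 * Real.cos θ) = Real.pi * d - Real.pi / 2 := by
      rw [hd]; ring
    rw [this, Real.sin_sub_pi_div_two, neg_sq]
  have hsymm : Real.cos (Real.pi * d) ^ 2 = Real.cos (Real.pi * e) ^ 2 := by
    have : Real.pi * d = ((m + 1 : ℕ) : ℝ) * Real.pi - Real.pi * e := by
      push_cast
      rw [← hsum]; ring
    rw [this, Real.cos_nat_mul_pi_sub, mul_pow, ← pow_mul, mul_comm (m + 1), pow_mul]
    norm_num
  rw [hy, hx]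
  rcases le_total d (1 / 2) with h1 | h1
  · linarith [quarter_le_of_arc hd0 h1 (by linarith : 1 ≤ d + e)]
  rcases le_total e (1 / 2) with h2 | h2
  · rw [hsymm, mul_comm]
    linarith [quarter_le_of_arc he0 h2 (by linarith : 1 ≤ e + d)]
  · nlinarith [sq_nonneg (Real.cos (Real.pi * d))]

theorem holeLoop_radicand_nonneg (m : Fin 3) (θ : ℝ) :
    0 ≤ (4 - (-(((m : ℕ) + 1) / 2 * Real.sin θ)) ^ 2) *
      ((-(((m : ℕ) + 1) / 2 * Real.sin θ)) ^ 2 +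
        Real.sin (Real.pi * ((m : ℕ) / 2 - ((m : ℕ) + 1) / 2 * Real.cos θ)) ^ 2 - 1 / 4) := by
  rw [neg_sq]
  refine mul_nonneg ?_ (quarter_le_on_circle m θ)
  have hm : ((m : ℕ) : ℝ) ≤ 2 := by exact_mod_cast Nat.le_of_lt_succ m.2
  have hm0 : (0 : ℝ) ≤ (m : ℕ) := Nat.cast_nonneg _
  have h2 : (((m : ℕ) + 1) / 2 : ℝ) ^ 2 ≤ 4 := by nlinarith
  have h3 := mul_le_mul h2 (Real.sin_sq_le_one θ) (sq_nonneg _) (by norm_num)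
  rw [mul_pow]
  linarith

/-- The loop on the upper half of the ladder over the circle in the plane that starts at `(-1/2, 0)`
and runs around the holes at `0, …, m`. -/
def holeLoop (m : Fin 3) : C(unitInterval, Ladder) where
  toFun t :=
    ⟨((m : ℕ) / 2 - ((m : ℕ) + 1) / 2 * Real.cos (2 * Real.pi * t),
      -(((m : ℕ) + 1) / 2 * Real.sin (2 * Real.pi * t)),
      √((4 - (-(((m : ℕ) + 1) / 2 * Real.sin (2 * Real.pi * t))) ^ 2) *
        ((-(((m : ℕ) + 1) / 2 * Real.sin (2 * Real.pi * t))) ^ 2 + Real.sin (Real.pi *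
          ((m : ℕ) / 2 - ((m : ℕ) + 1) / 2 * Real.cos (2 * Real.pi * t))) ^ 2 - 1 / 4))),
      Real.sq_sqrt (holeLoop_radicand_nonneg m (2 * Real.pi * t))⟩
  continuous_toFun := by fun_prop

theorem holeLoop_zero (m : Fin 3) : holeLoop m 0 = holeLoop 0 0 := by
  apply Subtype.ext
  have : ((m : ℕ) : ℝ) / 2 - ((m : ℕ) + 1) / 2 = -(1 / 2) := by ring
  simp [holeLoop, this]

theorem holeLoop_one (m : Fin 3) : holeLoop m 1 = holeLoop 0 0 := by
  rw [← holeLoop_zero m]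
  apply Subtype.ext
  simp [holeLoop]

/-- The projection of the ladder to the plane, seen from the `j`-th hole. -/
def holeCoord (j : Fin 3) (v : Ladder) : ℂ := ⟨v.1.1 - (j : ℕ), v.1.2.1⟩

theorem continuous_holeCoord (j : Fin 3) : Continuous (holeCoord j) := by
  have : holeCoord j = fun v => Complex.equivRealProdCLM.symm (v.1.1 - (j : ℕ), v.1.2.1) := rfl
  rw [this]
  exact Complex.equivRealProdCLM.symm.continuous.comp (by fun_prop)

/-- Over the centre `(j, 0)` of a hole the equation of the ladder would read `z ^ 2 = -1`. -/
theorem holeCoord_ne_zero (j : Fin 3) (v : Ladder) : holeCoord j v ≠ 0 := by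
  intro h
  have h1 : v.1.1 - (j : ℕ) = 0 := congrArg Complex.re h
  have h2 : v.1.2.1 = 0 := congrArg Complex.im h
  have h3 : v.1.2.2 ^ 2 =
      (4 - v.1.2.1 ^ 2) * (v.1.2.1 ^ 2 + Real.sin (Real.pi * v.1.1) ^ 2 - 1 / 4) := v.2
  rw [sub_eq_zero.1 h1, h2, mul_comm Real.pi, Real.sin_nat_mul_pi] at h3
  nlinarith [sq_nonneg v.1.2.2]

theorem holeCoord_holeLoop (m j : Fin 3) (t : unitInterval) :
    holeCoord j (holeLoop m t) = (((m : ℕ) / 2 - (j : ℕ) : ℝ) : ℂ) -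
      ((((m : ℕ) + 1) / 2 : ℝ) : ℂ) * Complex.exp (2 * Real.pi * t * Complex.I) := by
  have h : (2 * Real.pi * t * Complex.I : ℂ) = ((2 * Real.pi * t : ℝ) : ℂ) * Complex.I := by
    push_cast; ring
  rw [h, Complex.exp_mul_I, ← Complex.ofReal_cos, ← Complex.ofReal_sin]
  apply Complex.ext
  · rw [Complex.sub_re, Complex.re_ofReal_mul, Complex.add_re, Complex.ofReal_re, Complex.ofReal_re,
      Complex.re_ofReal_mul, Complex.I_re]
    simp only [holeCoord, holeLoop, ContinuousMap.coe_mk]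
    ring
  · rw [Complex.sub_im, Complex.im_ofReal_mul, Complex.add_im, Complex.ofReal_im, Complex.ofReal_im,
      Complex.im_ofReal_mul, Complex.I_im]
    simp only [holeCoord, holeLoop, ContinuousMap.coe_mk]
    ring

/-- Winding number one: a logarithm along a circle around the origin. -/
theorem exists_log_circle_inside {a ρ : ℝ} (h : |a| < ρ) :
    ∃ L : unitInterval → ℂ, Continuous L ∧
      (∀ t : unitInterval, Complex.exp (L t) = a - ρ * Complex.exp (2 * Real.pi * t * Complex.I)) ∧
      L 1 - L 0 = 2 * Real.pi * Complex.I := by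
  have hρ : 0 < ρ := (abs_nonneg a).trans_lt h
  have hρ' : (ρ : ℂ) ≠ 0 := Complex.ofReal_ne_zero.2 hρ.ne'
  -- The circle is `-ρ exp(2πit) (1 + u)` with `‖u‖ = |a| / ρ < 1`, so `1 + u` has a continuous
  -- principal logarithm and the middle factor carries the winding.
  let u : unitInterval → ℂ := fun t => -((a / ρ : ℝ) : ℂ) * Complex.exp (-(2 * Real.pi * t * Complex.I))
  have hu : ∀ t, 1 + u t ∈ Complex.slitPlane := by
    intro t
    refine Complex.mem_slitPlane_of_norm_lt_one ?_
    have h1 : (-(2 * Real.pi * t * Complex.I) : ℂ) = ((-(2 * Real.pi * t) : ℝ) : ℂ) * Complex.I := by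
      push_cast; ring
    rw [norm_mul, h1, Complex.norm_exp_ofReal_mul_I, mul_one, norm_neg, Complex.norm_real,
      Real.norm_eq_abs, abs_div, abs_of_pos hρ, div_lt_one hρ]
    exact h
  refine ⟨fun t => Complex.log (-ρ) + 2 * Real.pi * t * Complex.I + Complex.log (1 + u t), ?_, ?_, ?_⟩
  · have hc : Continuous fun t => Complex.log (1 + u t) :=
      Continuous.clog (by fun_prop) hu
    fun_prop
  · intro t
    rw [Complex.exp_add, Complex.exp_add, Complex.exp_log (neg_ne_zero.2 hρ'),
      Complex.exp_log (Complex.slitPlane_ne_zero (hu t))]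
    have h2 := Complex.exp_ne_zero (2 * Real.pi * t * Complex.I)
    simp only [u, Complex.exp_neg]
    push_cast
    field_simp
    ring
  · have h3 : u 1 = u 0 := by
      simp [u, Complex.exp_neg]
    simp [h3]

/-- Winding number zero: a logarithm along a circle that does not surround the origin. -/
theorem exists_log_circle_outside {a ρ : ℝ} (hρ : 0 < ρ) (h : ρ < |a|) :
    ∃ L : unitInterval → ℂ, Continuous L ∧
      (∀ t : unitInterval, Complex.exp (L t) = a - ρ * Complex.exp (2 * Real.pi * t * Complex.I)) ∧
      L 1 - L 0 = 0 := by
  have ha : a ≠ 0 := by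
    rintro rfl
    simp at h
    linarith
  have ha' : (a : ℂ) ≠ 0 := Complex.ofReal_ne_zero.2 ha
  let u : unitInterval → ℂ := fun t => -((ρ / a : ℝ) : ℂ) * Complex.exp (2 * Real.pi * t * Complex.I)
  have hu : ∀ t, 1 + u t ∈ Complex.slitPlane := by
    intro t
    refine Complex.mem_slitPlane_of_norm_lt_one ?_
    have h1 : (2 * Real.pi * t * Complex.I : ℂ) = ((2 * Real.pi * t : ℝ) : ℂ) * Complex.I := by
      push_cast; ring
    rw [norm_mul, h1, Complex.norm_exp_ofReal_mul_I, mul_one, norm_neg, Complex.norm_real,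
      Real.norm_eq_abs, abs_div, abs_of_pos hρ, div_lt_one (abs_pos.2 ha)]
    exact h
  refine ⟨fun t => Complex.log a + Complex.log (1 + u t), ?_, ?_, ?_⟩
  · have hc : Continuous fun t => Complex.log (1 + u t) :=
      Continuous.clog (by fun_prop) hu
    fun_prop
  · intro t
    rw [Complex.exp_add, Complex.exp_log ha', Complex.exp_log (Complex.slitPlane_ne_zero (hu t))]
    simp only [u]
    push_cast
    field_simp
    ring
  · have h3 : u 1 = u 0 := by
      simp [u]
    simp [h3]

/-- The `j`-th hole lies inside the `m`-th circle exactly when `|m / 2 - j| < (m + 1) / 2`, that is,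
when `j ≤ m`. -/
theorem exists_log_holeLoop (m j : Fin 3) : ∃ L : unitInterval → ℂ, Continuous L ∧
    (∀ t, Complex.exp (L t) = holeCoord j (holeLoop m t)) ∧
    L 1 - L 0 = if j ≤ m then 2 * Real.pi * Complex.I else 0 := by
  simp only [holeCoord_holeLoop]
  have hm : (0 : ℝ) ≤ (m : ℕ) := Nat.cast_nonneg _
  have hj : (0 : ℝ) ≤ (j : ℕ) := Nat.cast_nonneg _
  split_ifs with h
  · have h' : ((j : ℕ) : ℝ) ≤ (m : ℕ) := by exact_mod_cast h
    refine exists_log_circle_inside ?_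
    rw [abs_lt]
    constructor <;> linarith
  · have h' : ((m : ℕ) : ℝ) + 1 ≤ (j : ℕ) := by exact_mod_cast not_le.1 h
    refine exists_log_circle_outside (by positivity) ?_
    rw [abs_of_neg (by linarith)]
    linarith

/-- The ladder has no flat structure. -/
theorem isEmpty_flatStructure_ladder (ε : ℝ) : IsEmpty (FlatStructure Ladder ε) := by
  refine ⟨fun S => ?_⟩
  choose L hL hexp hdiff using exists_log_holeLoop
  exact S.false_of_windings continuous_holeCoord holeCoord_ne_zero holeLoop_zero holeLoop_one
    hL hexp hdiff

/-! ### The deck transformations of the cyclic cover -/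

theorem handleShift_zpow (k n : ℤ) : handleShift k ^ n = handleShift (n * k) := by
  let φ : Multiplicative ℤ →* (Ladder ≃ₜ Ladder) :=
    { toFun := fun a => handleShift a.toAdd
      map_one' := by ext <;> simp [handleShift]
      map_mul' := fun a b => by
        ext v
        · simp [handleShift]; ring
        · simp [handleShift]
        · simp [handleShift] }
  have h := map_zpow φ (Multiplicative.ofAdd k) n
  rw [← ofAdd_zsmul, smul_eq_mul] at h
  exact h.symm

theorem ladderCover_eq_iff {g : ℕ} {v w : Ladder} :
    ladderCover g v = ladderCover g w ↔ ∃ n : ℤ, handleShift (n * ((g : ℤ) - 1)) v = w := by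
  rw [ladderCover, Quotient.eq]
  simp only [← handleShift_zpow]
  rfl

theorem ladderCover_handleShift (g : ℕ) (n : ℤ) (v : Ladder) :
    ladderCover g (handleShift (n * ((g : ℤ) - 1)) v) = ladderCover g v :=
  (ladderCover_eq_iff.2 ⟨n, rfl⟩).symm

theorem continuous_ladderCover (g : ℕ) : Continuous (ladderCover g) := continuous_quot_mk

theorem isOpenMap_ladderCover (g : ℕ) : IsOpenMap (ladderCover g) := by
  intro U hU
  have h : ladderCover g ⁻¹' (ladderCover g '' U) =
      ⋃ n : ℤ, handleShift (n * ((g : ℤ) - 1)) ⁻¹' U := by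
    ext v
    simp only [Set.mem_preimage, Set.mem_image, Set.mem_iUnion]
    constructor
    · rintro ⟨u, hu, huv⟩
      obtain ⟨n, rfl⟩ := ladderCover_eq_iff.1 huv.symm
      exact ⟨n, hu⟩
    · rintro ⟨n, hn⟩
      exact ⟨_, hn, ladderCover_handleShift g n v⟩
  change IsOpen (ladderCover g ⁻¹' (ladderCover g '' U))
  rw [h]
  exact isOpen_iUnion fun n => hU.preimage (Homeomorph.continuous _)

/-- Deck transformations move `x` by integers, so the covering is injective over an open interval of
length one. -/
theorem isLocalHomeomorph_ladderCover (g : ℕ) : IsLocalHomeomorph (ladderCover g) := by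
  rw [isLocalHomeomorph_iff_isOpenEmbedding_restrict]
  intro x
  let U : Set Ladder := {v | |v.1.1 - x.1.1| < 1 / 2}
  have hU : IsOpen U := isOpen_lt (by fun_prop) continuous_const
  refine ⟨U, hU.mem_nhds (by simp [U]), ?_⟩
  refine IsOpenEmbedding.of_continuous_injective_isOpenMap
    ((continuous_ladderCover g).comp continuous_subtype_val) ?_
    ((isOpenMap_ladderCover g).comp hU.isOpenEmbedding_subtypeVal.isOpenMap)
  rintro ⟨v, hv⟩ ⟨w, hw⟩ hvw
  obtain ⟨n, hn⟩ := ladderCover_eq_iff.1 (show ladderCover g v = ladderCover g w from hvw)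
  have h1 : v.1.1 + ((n * ((g : ℤ) - 1) : ℤ) : ℝ) = w.1.1 := congrArg (fun u : Ladder => u.1.1) hn
  have h2 : |((n * ((g : ℤ) - 1) : ℤ) : ℝ)| < 1 := by
    rw [show ((n * ((g : ℤ) - 1) : ℤ) : ℝ) = (w.1.1 - x.1.1) - (v.1.1 - x.1.1) by linarith]
    have hv' : |v.1.1 - x.1.1| < 1 / 2 := hv
    have hw' : |w.1.1 - x.1.1| < 1 / 2 := hw
    exact (abs_sub _ _).trans_lt (by linarith)
  have h3 : n * ((g : ℤ) - 1) = 0 := Int.abs_lt_one_iff.1 (by exact_mod_cast h2)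
  have h4 : handleShift (0 * ((g : ℤ) - 1)) v = w := by
    rw [← hn, h3, zero_mul]
  rw [← handleShift_zpow, zpow_zero] at h4
  exact Subtype.ext h4

/-! ### A compact set that meets every deck orbit. -/

/-- The part of the ladder over `0 ≤ x ≤ a`. -/
def ladderSegment (a : ℝ) : Set Ladder := {v | 0 ≤ v.1.1 ∧ v.1.1 ≤ a}

theorem isCompact_ladderSegment (a : ℝ) : IsCompact (ladderSegment a) := by
  rw [Subtype.isCompact_iff]
  have hclosed : IsClosed ladderSet := isClosed_eq (by fun_prop) (by fun_prop)
  refine (isCompact_Icc (a := ((0, -2, -5) : ℝ × ℝ × ℝ)) (b := (a, 2, 5))).of_isClosed_subset ?_ ?_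
  · have : Subtype.val '' ladderSegment a = ladderSet ∩ {v | 0 ≤ v.1 ∧ v.1 ≤ a} := by
      ext v
      constructor
      · rintro ⟨w, hw, rfl⟩
        exact ⟨w.2, hw⟩
      · rintro ⟨hv, hv'⟩
        exact ⟨⟨v, hv⟩, hv', rfl⟩
    rw [this]
    exact hclosed.inter ((isClosed_le continuous_const continuous_fst).inter
      (isClosed_le continuous_fst continuous_const))
  · rintro _ ⟨v, hv, rfl⟩
    have h : v.1.2.2 ^ 2 =
      (4 - v.1.2.1 ^ 2) * (v.1.2.1 ^ 2 + Real.sin (Real.pi * v.1.1) ^ 2 - 1 / 4) := v.2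
    have hs0 := sq_nonneg (Real.sin (Real.pi * v.1.1))
    have hs1 := Real.sin_sq_le_one (Real.pi * v.1.1)
    set s := Real.sin (Real.pi * v.1.1) ^ 2
    set y := v.1.2.1
    set z := v.1.2.2
    have hy : y ^ 2 ≤ 4 := by
      by_contra hcon
      push Not at hcon
      nlinarith [sq_nonneg z]
    have hz : z ^ 2 ≤ 25 := by
      rw [h]
      have := mul_le_mul_of_nonneg_left (show y ^ 2 + s - 1 / 4 ≤ 5 by linarith)
        (show 0 ≤ 4 - y ^ 2 by linarith)
      nlinarith [sq_nonneg y]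
    have hy' : |y| ≤ 2 := abs_le_of_sq_le_sq (by linarith) (by norm_num)
    have hz' : |z| ≤ 5 := abs_le_of_sq_le_sq (by linarith) (by norm_num)
    rw [abs_le] at hy' hz'
    exact ⟨⟨hv.1, hy'.1, hz'.1⟩, ⟨hv.2, hy'.2, hz'.2⟩⟩

theorem exists_handleShift_mem {g : ℕ} (hg : 2 ≤ g) (v : Ladder) :
    ∃ n : ℤ, handleShift (n * ((g : ℤ) - 1)) v ∈ ladderSegment ((g : ℝ) - 1) := by
  have hpos : (0 : ℝ) < (g : ℝ) - 1 := by
    have : (2 : ℝ) ≤ g := by exact_mod_cast hg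
    linarith
  refine ⟨-⌊v.1.1 / ((g : ℝ) - 1)⌋, ?_⟩
  change 0 ≤ v.1.1 + _ ∧ v.1.1 + _ ≤ _
  have h1 := Int.floor_le (v.1.1 / ((g : ℝ) - 1))
  have h2 := (Int.lt_floor_add_one (v.1.1 / ((g : ℝ) - 1))).le
  rw [le_div_iff₀ hpos] at h1
  rw [div_le_iff₀ hpos] at h2
  push_cast
  constructor <;> linarith

/-! ### The lifted foliations -/

namespace SingularMeasuredFoliation

/-- A deck transformation is a lift of the identity. -/
theorem lift_hasImage_handleShift (g : ℕ)
    (F : SingularMeasuredFoliation (ClosedSurface g)) (n : ℤ) :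
    (F.lift (isLocalHomeomorph_ladderCover g)).HasImage (handleShift (n * ((g : ℤ) - 1))) 1
      (F.lift (isLocalHomeomorph_ladderCover g)) :=
  HasImage.of_semiconj (hasImage_lift _ F) (hasImage_lift _ F) (HasImage.refl F)
    (continuous_ladderCover g) (Homeomorph.continuous _) (ladderCover_handleShift g n)

/-- A singularity exists, for otherwise the ladder would carry a flat structure; its translates
under the deck group are distinct singularities. -/
theorem Transverse.lift_sing_infinite {g : ℕ} (hg : 2 ≤ g)
    {F G : SingularMeasuredFoliation (ClosedSurface g)} (h : F.Transverse G) :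
    (F.lift (isLocalHomeomorph_ladderCover g)).sing.Infinite := by
  have hq := isLocalHomeomorph_ladderCover g
  have hne : (F.lift hq).sing ≠ ∅ := by
    intro hs
    obtain ⟨ε, ⟨S⟩⟩ := (h.lift hq).exists_flatStructure hs
      (isCompact_ladderSegment ((g : ℝ) - 1)) fun x => by
        obtain ⟨n, hn⟩ := exists_handleShift_mem hg x
        exact ⟨_, hn, lift_hasImage_handleShift g F n, lift_hasImage_handleShift g G n⟩
    exact (isEmpty_flatStructure_ladder ε).false S
  obtain ⟨x, hx⟩ := Set.nonempty_iff_ne_empty.2 hne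
  refine Set.infinite_of_injective_forall_mem
    (f := fun n : ℤ => handleShift (n * ((g : ℤ) - 1)) x) ?_ fun n => ?_
  · intro n m hnm
    have h1 : x.1.1 + ((n * ((g : ℤ) - 1) : ℤ) : ℝ) = x.1.1 + ((m * ((g : ℤ) - 1) : ℤ) : ℝ) :=
      congrArg (fun u : Ladder => u.1.1) hnm
    have h2 : n * ((g : ℤ) - 1) = m * ((g : ℤ) - 1) := by exact_mod_cast add_left_cancel h1
    exact mul_right_cancel₀ (by omega) h2
  · exact ((lift_hasImage_handleShift g F n).mem_sing_iff x).2 hx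

theorem _root_.Homeomorph.exists_coe_eq_iterate {X : Type*} [TopologicalSpace X] (e : X ≃ₜ X)
    (n : ℕ) :
    ∃ e' : X ≃ₜ X, ⇑e' = e^[n] := by
  induction n with
  | zero => exact ⟨Homeomorph.refl X, rfl⟩
  | succ n ih =>
    obtain ⟨e', he'⟩ := ih
    exact ⟨e.trans e', by rw [Function.iterate_succ, ← he']; rfl⟩

/-- The contracting maps are the iterates of `e`, each followed by a deck transformation that
returns the given point to the compact segment; the latter has factor `1` and does not affect the
contraction. -/
theorem Transverse.lift_isArational {g : ℕ} (hg : 2 ≤ g)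
    {F G : SingularMeasuredFoliation (ClosedSurface g)} (h : F.Transverse G) {e : Ladder ≃ₜ Ladder}
    {c : ℝ} (hc0 : 0 < c) (hc1 : c < 1)
    (hF : (F.lift (isLocalHomeomorph_ladderCover g)).HasImage e c
      (F.lift (isLocalHomeomorph_ladderCover g)))
    (hG : (G.lift (isLocalHomeomorph_ladderCover g)).HasImage e c⁻¹
      (G.lift (isLocalHomeomorph_ladderCover g))) :
    (F.lift (isLocalHomeomorph_ladderCover g)).IsArational := by
  have hq := isLocalHomeomorph_ladderCover g
  refine isArational_of_contracting (h.lift hq) (isCompact_ladderSegment ((g : ℝ) - 1)) hc0 hc1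
    fun n x => ?_
  obtain ⟨e', he'⟩ := e.exists_coe_eq_iterate n
  obtain ⟨k, hk⟩ := exists_handleShift_mem hg (e' x)
  refine ⟨e'.trans (handleShift (k * ((g : ℤ) - 1))), hk, ?_, ?_⟩
  · have h1 := (he' ▸ hF.iterate e.continuous n).comp (lift_hasImage_handleShift g F k) e'.continuous
    rwa [mul_one] at h1
  · have h1 := (he' ▸ hG.iterate e.continuous n).comp (lift_hasImage_handleShift g G k) e'.continuous
    rwa [mul_one, inv_pow] at h1

end SingularMeasuredFoliation

end

/-! ### The theorem. -/

open SingularMeasuredFoliation in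
theorem mainTheorem6 (g : ℕ) (hg : 3 ≤ g)
    (f : ClosedSurface g ≃ₜ ClosedSurface g)
    (Fs Fu : SingularMeasuredFoliation (ClosedSurface g)) (lam : ℝ)
    (hf : IsPseudoAnosov f Fs Fu lam)
    (ft : Ladder ≃ₜ Ladder)
    (hft : ∀ v : Ladder, ladderCover g (ft v) = f (ladderCover g v)) :
    ∃ Fs' Fu' : SingularMeasuredFoliation Ladder,
      Fs'.Transverse Fu' ∧
      Fs'.IsArational ∧ Fu'.IsArational ∧
      Fs'.HasCountablyInfiniteIsolatedSing ∧ Fu'.HasCountablyInfiniteIsolatedSing ∧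
      Fs'.HasImage (ladderCover g) 1 Fs ∧ Fu'.HasImage (ladderCover g) 1 Fu ∧
      Fu'.HasImage ft lam Fu' ∧ Fs'.HasImage ft lam⁻¹ Fs' := by
  have hg2 : 2 ≤ g := by omega
  have hq := isLocalHomeomorph_ladderCover g
  have hlam : 0 < lam := one_pos.trans hf.one_lt
  have hlam' : lam⁻¹ < 1 := inv_lt_one_of_one_lt₀ hf.one_lt
  have hu : (Fu.lift hq).HasImage ft lam (Fu.lift hq) :=
    HasImage.of_semiconj (hasImage_lift hq Fu) (hasImage_lift hq Fu) hf.unstable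
      (continuous_ladderCover g) ft.continuous hft
  have hs : (Fs.lift hq).HasImage ft lam⁻¹ (Fs.lift hq) :=
    HasImage.of_semiconj (hasImage_lift hq Fs) (hasImage_lift hq Fs) hf.stable
      (continuous_ladderCover g) ft.continuous hft
  refine ⟨Fs.lift hq, Fu.lift hq, hf.transverse.lift hq, ?_, ?_,
    hasCountablyInfiniteIsolatedSing _ (hf.transverse.lift_sing_infinite hg2),
    hasCountablyInfiniteIsolatedSing _ (hf.transverse.symm.lift_sing_infinite hg2),
    hasImage_lift hq Fs, hasImage_lift hq Fu, hu, hs⟩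
  · exact hf.transverse.lift_isArational hg2 (inv_pos.2 hlam) hlam' hs (by rwa [inv_inv])
  -- The leaves of the unstable foliation are contracted by the inverse of `ft`.
  · exact hf.transverse.symm.lift_isArational hg2 (inv_pos.2 hlam) hlam' (hu.symm hlam.ne')
      (hs.symm (inv_pos.2 hlam).ne')
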